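/- **Theorem 1.2.** Let $d\ge 1$, let $d<p<\infty$, let $D\subset\mathbb{R}^d$ be an open set of finite Lebesgue measure, let $f\in W^{-1,p'}(D)$, the dual of $W^{1,p}_0(D)$, and let $0<m\le|D|$. For every open set $\Omega\subset D$, the state function $u_\Omega$ is the solution of $$\min\Big\{\int_D\frac1p|\nabla u|^p\,dx-\langle f,u\rangle\ :\ u\in W^{1,p}_0(D),\ u=0\text{ on }D\setminus\Omega\Big\},$$ where $u=0$ on $D\setminus\Omega$ is understood pointwise, for the continuous representative of $u$ (which exists because $p>d$); equivalently, $u_\Omega$ is the weak solution of $-\operatorname{div}(|\nabla u|^{p-2}\nabla u)=f$ in $\Omega$ with $u=0$ on $\overline D\setminus\Omega$. Let $j:D\times\mathbb{R}\to\mathbb{R}$ be measurable with respect to the product of the Lebesgue $\sigma$-algebra on $D$ and the Borel $\sigma$-algebra on $\mathbb{R}$, with $j(x,\cdot)$ lower semicontinuous for a.e. $x\in D$, and put $$J(u)=\int_D j(x,u(x))\,dx .$$ Suppose that for every $M>0$ there exists $a_M\in L^1(D)$ such that $$-a_M(x)\le j(x,s)\qquad\text{for a.e. }x\in D\text{ and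 all }|s|\le M .$$ Then for every open $\Omega\subset D$ the state function $u_\Omega$ exists and is unique, and $J(u_\Omega)$ is well defined in $(-\infty,+\infty]$ (the negative part of $j(\cdot,u_\Omega)$ is integrable on $D$). Moreover, the minimization problem $$\min\big\{J(u_\Omega)\ :\ \Omega\text{ open},\ \Omega\subset D,\ |\Omega|\le m\big\}$$ admits a solution: there is an open set $\Omega_{\mathrm{opt}}\subset D$ with $|\Omega_{\mathrm{opt}}|\le m$ such that $J(u_{\Omega_{\mathrm{opt}}})\le J(u_\Omega)$ for every open set $\Omega\subset D$ with $|\Omega|\le m$. -/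

import Mathlib

open MeasureTheory
open scoped ENNReal ContDiff

noncomputable section

/-- The pairs `(φ, ∇φ)` with `φ ∈ C_c^∞(D)` (extended by zero), as a subspace of
`L^p(ℝ^d) × L^p(ℝ^d; ℝ^d)`. -/
def testPairs {d : ℕ} (D : Set (EuclideanSpace ℝ (Fin d))) (p : ℝ≥0∞) [Fact (1 ≤ p)] :
    Submodule ℝ (Lp ℝ p (volume : Measure (EuclideanSpace ℝ (Fin d))) ×
      Lp (EuclideanSpace ℝ (Fin d)) p (volume : Measure (EuclideanSpace ℝ (Fin d)))) where
  carrier := {w | ∃ φ : EuclideanSpace ℝ (Fin d) → ℝ, ContDiff ℝ ∞ φ ∧ HasCompactSupport φ ∧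
    tsupport φ ⊆ D ∧ w.1 =ᵐ[volume] φ ∧ w.2 =ᵐ[volume] gradient φ}
  zero_mem' := by
    refine ⟨0, contDiff_const, HasCompactSupport.zero, by simp [tsupport], Lp.coeFn_zero .., ?_⟩
    filter_upwards [Lp.coeFn_zero (EuclideanSpace ℝ (Fin d)) p
      (volume : Measure (EuclideanSpace ℝ (Fin d)))] with x hx
    refine Eq.trans hx ?_
    simp [gradient]
  add_mem' := by
    rintro v w ⟨φ, h1, h2, h3, h4, h5⟩ ⟨ψ, k1, k2, k3, k4, k5⟩
    refine ⟨φ + ψ, h1.add k1, h2.add k2,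
      (tsupport_add φ ψ).trans (Set.union_subset h3 k3), ?_, ?_⟩
    · exact (Lp.coeFn_add v.1 w.1).trans (h4.add k4)
    · refine (Lp.coeFn_add v.2 w.2).trans ((h5.add k5).trans (Filter.Eventually.of_forall ?_))
      intro x
      have hφ : DifferentiableAt ℝ φ x := h1.differentiable (by simp) x
      have hψ : DifferentiableAt ℝ ψ x := k1.differentiable (by simp) x
      simp [gradient, fderiv_add hφ hψ]
  smul_mem' := by
    rintro c v ⟨φ, h1, h2, h3, h4, h5⟩
    refine ⟨c • φ, contDiff_const.smul h1, h2.smul_left (f := fun _ => c),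
      (closure_mono (Function.support_const_smul_subset c φ)).trans h3, ?_, ?_⟩
    · exact (Lp.coeFn_smul c v.1).trans (h4.const_smul c)
    · refine (Lp.coeFn_smul c v.2).trans
        ((h5.const_smul c).trans (Filter.Eventually.of_forall ?_))
      intro x
      have hφ : DifferentiableAt ℝ φ x := h1.differentiable (by simp) x
      simp [gradient, fderiv_const_smul hφ]

/-- The Sobolev space `W_0^{1,p}(D)`: the closure of `C_c^∞(D)` in the `W^{1,p}` norm, its
elements being recorded as pairs `(u, ∇u)`, extended by zero outside `D`. The norm inherited from
the product, `max (‖u‖_p) (‖∇u‖_p)`, is equivalent to the usual `W^{1,p}` norm. -/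
def SobolevZero {d : ℕ} (D : Set (EuclideanSpace ℝ (Fin d))) (p : ℝ≥0∞) [Fact (1 ≤ p)] :
    Submodule ℝ (Lp ℝ p (volume : Measure (EuclideanSpace ℝ (Fin d))) ×
      Lp (EuclideanSpace ℝ (Fin d)) p (volume : Measure (EuclideanSpace ℝ (Fin d)))) :=
  (testPairs D p).topologicalClosure

/-- The function `u` underlying an element of `W_0^{1,p}(D)`. -/
def sobolevVal {d : ℕ} {D : Set (EuclideanSpace ℝ (Fin d))} {p : ℝ≥0∞} [Fact (1 ≤ p)]
    (u : SobolevZero D p) : EuclideanSpace ℝ (Fin d) → ℝ :=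
  (u : Lp ℝ p (volume : Measure (EuclideanSpace ℝ (Fin d))) ×
    Lp (EuclideanSpace ℝ (Fin d)) p (volume : Measure (EuclideanSpace ℝ (Fin d)))).1

/-- The weak gradient `∇u` of an element of `W_0^{1,p}(D)`. -/
def sobolevGrad {d : ℕ} {D : Set (EuclideanSpace ℝ (Fin d))} {p : ℝ≥0∞} [Fact (1 ≤ p)]
    (u : SobolevZero D p) : EuclideanSpace ℝ (Fin d) → EuclideanSpace ℝ (Fin d) :=
  (u : Lp ℝ p (volume : Measure (EuclideanSpace ℝ (Fin d))) ×
    Lp (EuclideanSpace ℝ (Fin d)) p (volume : Measure (EuclideanSpace ℝ (Fin d)))).2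

/-- The continuous representative of `u` exists and vanishes at every point of `S`. (For `p > d`
every element of `W_0^{1,p}(D)` has a continuous representative on `ℝ^d`, which is unique.) -/
def VanishesOn {d : ℕ} (u : EuclideanSpace ℝ (Fin d) → ℝ)
    (S : Set (EuclideanSpace ℝ (Fin d))) : Prop :=
  ∃ v : EuclideanSpace ℝ (Fin d) → ℝ, Continuous v ∧ v =ᵐ[volume] u ∧ ∀ x ∈ S, v x = 0

/-- The energy `∫_D (1/p) |∇u|^p dx - ⟨f, u⟩`, where `f ∈ W^{-1,p'}(D)` is a continuous linear
functional on `W_0^{1,p}(D)`. -/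
def pEnergy {d : ℕ} {D : Set (EuclideanSpace ℝ (Fin d))} {p : ℝ≥0∞} [Fact (1 ≤ p)]
    (f : SobolevZero D p →L[ℝ] ℝ) (u : SobolevZero D p) : ℝ :=
  (∫ x in D, (1 / p.toReal) * ‖sobolevGrad u x‖ ^ p.toReal) - f u

/-- `u` is the state function `u_Ω`: it minimizes the energy among all `v ∈ W_0^{1,p}(D)` with
`v = 0` on `D \ Ω`. -/
def IsState {d : ℕ} {D : Set (EuclideanSpace ℝ (Fin d))} {p : ℝ≥0∞} [Fact (1 ≤ p)]
    (f : SobolevZero D p →L[ℝ] ℝ) (Ω : Set (EuclideanSpace ℝ (Fin d)))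
    (u : SobolevZero D p) : Prop :=
  VanishesOn (sobolevVal u) (D \ Ω) ∧
    ∀ v : SobolevZero D p, VanishesOn (sobolevVal v) (D \ Ω) → pEnergy f u ≤ pEnergy f v

/-- The integral over `D` of the positive part of `x ↦ j (x, u x)`. -/
def costPos {d : ℕ} (D : Set (EuclideanSpace ℝ (Fin d))) (j : EuclideanSpace ℝ (Fin d) → ℝ → ℝ)
    (u : EuclideanSpace ℝ (Fin d) → ℝ) : ℝ≥0∞ :=
  ∫⁻ x in D, ENNReal.ofReal (j x (u x))

/-- The integral over `D` of the negative part of `x ↦ j (x, u x)`. -/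
def costNeg {d : ℕ} (D : Set (EuclideanSpace ℝ (Fin d))) (j : EuclideanSpace ℝ (Fin d) → ℝ → ℝ)
    (u : EuclideanSpace ℝ (Fin d) → ℝ) : ℝ≥0∞ :=
  ∫⁻ x in D, ENNReal.ofReal (-j x (u x))

/-- The cost `J(u) = ∫_D j(x, u(x)) dx`, with values in `(-∞, +∞]` whenever the negative part
has a finite integral. -/
def cost {d : ℕ} (D : Set (EuclideanSpace ℝ (Fin d))) (j : EuclideanSpace ℝ (Fin d) → ℝ → ℝ)
    (u : EuclideanSpace ℝ (Fin d) → ℝ) : EReal :=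
  (costPos D j u : EReal) - (costNeg D j u : EReal)

/-- The admissible class: open subsets of `D` of Lebesgue measure at most `m`. -/
def IsAdmissible {d : ℕ} (D : Set (EuclideanSpace ℝ (Fin d))) (m : ℝ)
    (Ω : Set (EuclideanSpace ℝ (Fin d))) : Prop :=
  IsOpen Ω ∧ Ω ⊆ D ∧ volume Ω ≤ ENNReal.ofReal m

end

/-! ### Morrey's inequality for `C^1` functions. -/

section Morrey

open Set

/-! The proof is the direct method, made to work by `p > d`. By Morrey's inequality every `u` in
`W_0^{1,p}(D)` has a continuous representative whose Hölder and sup norms are bounded by `‖∇u‖_p`.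
Point evaluations are therefore continuous, and a pointwise zero constraint survives limits.

Open sets are sequentially compact for a Hausdorff-type convergence of complements
(`exists_subseq_domainTendsto`), and the constraint `|Ω| ≤ m` passes to the limit by inner
regularity. Along such a sequence the states converge strongly (`IsMorreyDomain.tendsto_state`). A
truncation of the limit state is supported in a compact subset of `Ω₀`, hence is eventually a
competitor on `Ω n`, which bounds the energies from above. Conversely, the uniform Hölder bound
forces zeros outside `Ω n` to persist outside `Ω₀`, which bounds them from below by the minimality
of the limit state.

No weak topology is used. A quantitative strict convexity of `‖·‖^p` makes a sequence Cauchy as soon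
as its midpoint energy gaps are small, and the intersection of the closed convex hulls of the tails
plays the role of the set of weak limits. The same argument gives existence and uniqueness of
states.

Strong convergence gives uniformly bounded, pointwise convergent representatives, so Fatou's lemma
for `j + |a_M|` yields lower semicontinuity of the cost along a minimizing sequence. -/

theorem enorm_sub_le_lintegral_fderiv {V : Type*} [NormedAddCommGroup V]
    [NormedSpace ℝ V] {φ : V → ℝ} (hφ : ContDiff ℝ 1 φ) (y z : V) :
    ‖φ z - φ y‖ₑ ≤
      ENNReal.ofReal ‖z - y‖ * ∫⁻ t in Ioc (0 : ℝ) 1, ‖fderiv ℝ φ (y + t • (z - y))‖ₑ := by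
  have hcont : Continuous fun t : ℝ => fderiv ℝ φ (y + t • (z - y)) :=
    (hφ.continuous_fderiv one_ne_zero).comp (by fun_prop)
  have hd : ∀ t ∈ uIcc (0 : ℝ) 1, HasDerivAt (fun t : ℝ => φ (y + t • (z - y)))
      (fderiv ℝ φ (y + t • (z - y)) (z - y)) t := by
    intro t _
    have h1 : HasDerivAt (fun t : ℝ => y + t • (z - y)) (z - y) t := by
      simpa using ((hasDerivAt_id t).smul_const (z - y)).const_add y
    exact ((hφ.differentiable one_ne_zero) _).hasFDerivAt.comp_hasDerivAt t h1
  have h2 := intervalIntegral.integral_eq_sub_of_hasDerivAt hd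
    ((hcont.clm_apply continuous_const).intervalIntegrable 0 1)
  simp only [one_smul, add_sub_cancel, zero_smul, add_zero] at h2
  rw [← h2, intervalIntegral.integral_of_le zero_le_one]
  refine (enorm_integral_le_lintegral_enorm _).trans ?_
  rw [← lintegral_const_mul' _ _ ENNReal.ofReal_ne_top]
  refine lintegral_mono fun t => ?_
  rw [ofReal_norm, mul_comm]
  exact ContinuousLinearMap.le_opENorm _ _

variable {V : Type*} [NormedAddCommGroup V] [NormedSpace ℝ V] [FiniteDimensional ℝ V]
  [MeasurableSpace V] [BorelSpace V] (μ : Measure V) [μ.IsAddHaarMeasure]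

theorem lintegral_comp_add_smul {s : ℝ} (hs : s ≠ 0) (a : V) {G : V → ℝ≥0∞} (hG : Measurable G) :
    ∫⁻ h, G (a + s • h) ∂μ =
      ENNReal.ofReal |(s ^ Module.finrank ℝ V)⁻¹| * ∫⁻ x, G x ∂μ := by
  have h1 : ∫⁻ h, G (a + s • h) ∂μ = ∫⁻ y, G (a + y) ∂(μ.map (s • ·)) := by
    rw [lintegral_map (f := fun y => G (a + y)) (hG.comp (measurable_const_add a))
      (measurable_const_smul s)]
  rw [h1, Measure.map_addHaar_smul μ hs, lintegral_smul_measure, lintegral_add_left_eq_self]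
  rfl

/-- Hölder against the constant 1, then the change of variables `x = a + s h`. What matters is the
power of `s`: it is integrable at 0 when `q` exceeds the dimension. -/
theorem setLIntegral_ball_comp_le {q : ℝ} (hq : 1 < q) {s : ℝ} (hs : 0 < s) (a : V)
    {F : V → ℝ≥0∞} (hF : Measurable F) :
    ∫⁻ h in Metric.ball 0 1, F (a + s • h) ∂μ ≤
      ENNReal.ofReal (s ^ (-(Module.finrank ℝ V : ℝ) / q)) * (∫⁻ x, F x ^ q ∂μ) ^ (1 / q) *
        μ (Metric.ball 0 1) ^ (1 - 1 / q) := by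
  have hq0 : 0 < q := by linarith
  have hm : Measurable fun h => F (a + s • h) :=
    hF.comp ((measurable_const_smul s).const_add a)
  have hconj : q.HolderConjugate (q / (q - 1)) := Real.HolderConjugate.conjExponent hq
  have h1 := ENNReal.lintegral_mul_le_Lp_mul_Lq (μ.restrict (Metric.ball 0 1)) hconj
    hm.aemeasurable (aemeasurable_const (b := (1 : ℝ≥0∞)))
  have h2 : 1 / (q / (q - 1)) = 1 - 1 / q := by field_simp
  simp only [Pi.mul_apply, mul_one, ENNReal.one_rpow, lintegral_one, Measure.restrict_apply_univ,
    h2] at h1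
  refine h1.trans ?_
  gcongr
  calc (∫⁻ h in Metric.ball 0 1, F (a + s • h) ^ q ∂μ) ^ (1 / q)
      ≤ (∫⁻ h, F (a + s • h) ^ q ∂μ) ^ (1 / q) := by
        gcongr; exact Measure.restrict_le_self
    _ = _ := by
        rw [lintegral_comp_add_smul μ hs.ne' a (hF.pow_const q),
          ENNReal.mul_rpow_of_nonneg _ _ (by positivity),
          ENNReal.ofReal_rpow_of_nonneg (abs_nonneg _) (by positivity), abs_of_pos (by positivity),
          ← Real.rpow_natCast, ← Real.rpow_neg hs.le, ← Real.rpow_mul hs.le]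
        congr 4
        ring

theorem lintegral_rpow_unit_lt_top {b : ℝ} (hb : -1 < b) :
    ∫⁻ t in Ioc (0 : ℝ) 1, ENNReal.ofReal (t ^ b) < ⊤ := by
  have h := (intervalIntegral.intervalIntegrable_rpow' hb (a := 0) (b := 1)).1
  refine lt_of_le_of_lt (lintegral_mono fun t => ?_) h.2
  exact Real.ofReal_le_enorm _

/-- Integrate the derivative along the segments from `y` to `x + r h`, of length at most `2r`, and
swap the integrals. At time `t`, as `h` varies, the points of the segments fill a ball of radius `t
r`, whence the factor `(t r)^(-n/q)`. -/
theorem setLIntegral_ball_enorm_sub_le {q : ℝ} (hq : 1 < q) {φ : V → ℝ} (hφ : ContDiff ℝ 1 φ)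
    {x y : V} {r : ℝ} (hr : 0 < r) (hxy : dist x y ≤ r) :
    ∫⁻ h in Metric.ball 0 1, ‖φ (x + r • h) - φ y‖ₑ ∂μ ≤
      ENNReal.ofReal (2 * r) * (ENNReal.ofReal (r ^ (-(Module.finrank ℝ V : ℝ) / q)) *
        (∫⁻ x, ‖fderiv ℝ φ x‖ₑ ^ q ∂μ) ^ (1 / q) * μ (Metric.ball 0 1) ^ (1 - 1 / q) *
        ∫⁻ t in Ioc (0 : ℝ) 1, ENNReal.ofReal (t ^ (-(Module.finrank ℝ V : ℝ) / q))) := by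
  have hfc : Continuous (fderiv ℝ φ) := hφ.continuous_fderiv one_ne_zero
  have hmeas : Measurable fun x => ‖fderiv ℝ φ x‖ₑ := by fun_prop
  calc ∫⁻ h in Metric.ball 0 1, ‖φ (x + r • h) - φ y‖ₑ ∂μ
      ≤ ∫⁻ h in Metric.ball 0 1, (ENNReal.ofReal (2 * r) *
          ∫⁻ t in Ioc (0 : ℝ) 1, ‖fderiv ℝ φ (y + t • (x + r • h - y))‖ₑ) ∂μ := by
        refine setLIntegral_mono_ae' measurableSet_ball
          (Filter.Eventually.of_forall fun h hh => ?_)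
        refine (enorm_sub_le_lintegral_fderiv hφ y (x + r • h)).trans ?_
        gcongr
        have h1 : x + r • h - y = (x - y) + r • h := by abel
        rw [h1]
        refine (norm_add_le _ _).trans ?_
        rw [norm_smul, Real.norm_of_nonneg hr.le, ← dist_eq_norm]
        have : ‖h‖ < 1 := by simpa using hh
        nlinarith
    _ = ENNReal.ofReal (2 * r) * ∫⁻ t in Ioc (0 : ℝ) 1, ∫⁻ h in Metric.ball 0 1,
          ‖fderiv ℝ φ ((y + t • (x - y)) + (t * r) • h)‖ₑ ∂μ := by
        rw [lintegral_const_mul' _ _ ENNReal.ofReal_ne_top, lintegral_lintegral_swap]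
        · congr 1
          refine lintegral_congr fun t => lintegral_congr fun h => ?_
          congr 2
          rw [mul_smul, add_sub_right_comm, smul_add]
          abel_nf
        · have : SecondCountableTopology V := secondCountable_of_proper
          refine Continuous.aemeasurable ?_
          refine Continuous.enorm (hfc.comp ?_)
          fun_prop
    _ ≤ ENNReal.ofReal (2 * r) * ∫⁻ t in Ioc (0 : ℝ) 1,
        ENNReal.ofReal (r ^ (-(Module.finrank ℝ V : ℝ) / q)) *
        (∫⁻ x, ‖fderiv ℝ φ x‖ₑ ^ q ∂μ) ^ (1 / q) * μ (Metric.ball 0 1) ^ (1 - 1 / q) *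
        ENNReal.ofReal (t ^ (-(Module.finrank ℝ V : ℝ) / q)) := by
        gcongr ENNReal.ofReal (2 * r) * ?_
        refine setLIntegral_mono_ae (by fun_prop) (Filter.Eventually.of_forall fun t ht => ?_)
        refine (setLIntegral_ball_comp_le μ hq (mul_pos ht.1 hr) _ hmeas).trans_eq ?_
        rw [Real.mul_rpow ht.1.le hr.le, ENNReal.ofReal_mul (Real.rpow_nonneg ht.1.le _)]
        ring
    _ = _ := by rw [lintegral_const_mul _ (by fun_prop)]

/-- **Morrey's inequality** for `C^1` functions on a finite-dimensional space. -/
theorem exists_morrey_const {q : ℝ} (hq : 1 < q) (hdq : (Module.finrank ℝ V : ℝ) < q) :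
    ∃ C : ℝ≥0∞, C ≠ ⊤ ∧ ∀ φ : V → ℝ, ContDiff ℝ 1 φ → ∀ x y : V,
      ‖φ x - φ y‖ₑ ≤ C * ENNReal.ofReal (dist x y ^ (1 - (Module.finrank ℝ V : ℝ) / q)) *
        (∫⁻ x, ‖fderiv ℝ φ x‖ₑ ^ q ∂μ) ^ (1 / q) := by
  have hq0 : 0 < q := by linarith
  set n : ℝ := (Module.finrank ℝ V : ℝ) with hn
  set B : ℝ≥0∞ := μ (Metric.ball (0 : V) 1) with hB
  set K : ℝ≥0∞ := ∫⁻ t in Ioc (0 : ℝ) 1, ENNReal.ofReal (t ^ (-n / q)) with hK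
  have hB0 : B ≠ 0 := (Metric.measure_ball_pos μ 0 one_pos).ne'
  have hBt : B ≠ ⊤ := measure_ball_lt_top.ne
  -- This is where the dimension must be less than `q`: the exponent `-n/q` exceeds `-1`.
  have hKt : K ≠ ⊤ := by
    refine (lintegral_rpow_unit_lt_top ?_).ne
    rw [lt_div_iff₀ hq0]; linarith
  -- The triangle inequality through `φ (x + r h)` is integrated over the unit ball. Each of the two
  -- terms contributes a factor 2 from `2r`, and division by `B` turns the integral into an average.
  refine ⟨4 * B ^ (1 - 1 / q) * K / B, ?_, fun φ hφ x y => ?_⟩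
  · refine ENNReal.div_ne_top (ENNReal.mul_ne_top (ENNReal.mul_ne_top (by simp) ?_) hKt) hB0
    refine ENNReal.rpow_ne_top_of_nonneg ?_ hBt
    rw [sub_nonneg, div_le_one hq0]; exact hq.le
  rcases eq_or_ne x y with rfl | hxy
  · simp
  set r := dist x y with hr
  have hr0 : 0 < r := dist_pos.2 hxy
  set I : ℝ≥0∞ := (∫⁻ x, ‖fderiv ℝ φ x‖ₑ ^ q ∂μ) ^ (1 / q) with hI
  have h1 := setLIntegral_ball_enorm_sub_le μ hq hφ (x := x) (y := x) hr0 (by simpa using hr0.le)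
  have h2 := setLIntegral_ball_enorm_sub_le μ hq hφ (x := x) (y := y) hr0 le_rfl
  rw [← hn, ← hK, ← hB, ← hI] at h1 h2
  have hmeas : Measurable fun h : V => ‖φ (x + r • h) - φ x‖ₑ := by
    have := hφ.continuous
    exact (Continuous.enorm (by fun_prop)).measurable
  have h3 : ‖φ x - φ y‖ₑ * B ≤ ∫⁻ h in Metric.ball 0 1, ‖φ (x + r • h) - φ x‖ₑ ∂μ +
      ∫⁻ h in Metric.ball 0 1, ‖φ (x + r • h) - φ y‖ₑ ∂μ := by
    rw [← lintegral_add_left hmeas, hB, ← setLIntegral_const]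
    refine lintegral_mono fun h => ?_
    have : φ x - φ y = -(φ (x + r • h) - φ x) + (φ (x + r • h) - φ y) := by ring
    rw [this]
    refine (enorm_add_le _ _).trans_eq ?_
    rw [enorm_neg]
  have h4 : ENNReal.ofReal (2 * r) * ENNReal.ofReal (r ^ (-n / q)) =
      2 * ENNReal.ofReal (r ^ (1 - n / q)) := by
    have : 2 * r * r ^ (-n / q) = 2 * r ^ (1 - n / q) := by
      rw [sub_eq_add_neg, Real.rpow_add hr0, Real.rpow_one, neg_div]; ring
    rw [← ENNReal.ofReal_mul (by positivity), this, ENNReal.ofReal_mul (by norm_num)]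
    simp
  have h5 := h3.trans (add_le_add h1 h2)
  rw [← ENNReal.le_div_iff_mul_le (Or.inl hB0) (Or.inl hBt)] at h5
  refine h5.trans_eq ?_
  rw [← two_mul]
  simp only [div_eq_mul_inv] at h4 ⊢
  calc _ = 2 * (ENNReal.ofReal (2 * r) * ENNReal.ofReal (r ^ (-n * q⁻¹))) * I *
        B ^ (1 - 1 * q⁻¹) * K * B⁻¹ := by ring
    _ = _ := by rw [h4]; ring

end Morrey

/-! ### Continuous representatives, Morrey's embedding and Poincaré's inequality. -/

section ContinuousRepresentative

open Set Filter Topology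

/-- The setting of Morrey's embedding: `d < p < ∞` and `D` is open of finite measure. -/
structure IsMorreyDomain {d : ℕ} (D : Set (EuclideanSpace ℝ (Fin d))) (p : ℝ≥0∞) : Prop where
  one_le_dim : 1 ≤ d
  dim_lt : (d : ℝ≥0∞) < p
  ne_top : p ≠ ⊤
  isOpen : IsOpen D
  measure_lt_top : volume D < ⊤

variable {d : ℕ} {p : ℝ≥0∞} {D : Set (EuclideanSpace ℝ (Fin d))}

theorem IsMorreyDomain.dim_lt_toReal (h : IsMorreyDomain D p) : (d : ℝ) < p.toReal := by
  have := (ENNReal.toReal_lt_toReal (ENNReal.natCast_ne_top d) h.ne_top).2 h.dim_lt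
  simpa using this

theorem IsMorreyDomain.one_lt (h : IsMorreyDomain D p) : 1 < p.toReal := by
  have h1 : (1 : ℝ) ≤ d := by exact_mod_cast h.one_le_dim
  linarith [h.dim_lt_toReal]

theorem IsMorreyDomain.exponent_pos (h : IsMorreyDomain D p) : 0 < 1 - (d : ℝ) / p.toReal := by
  have := h.one_lt
  rw [sub_pos, div_lt_one (by linarith)]
  exact h.dim_lt_toReal

theorem norm_gradient (φ : EuclideanSpace ℝ (Fin d) → ℝ) (x : EuclideanSpace ℝ (Fin d)) :
    ‖gradient φ x‖ = ‖fderiv ℝ φ x‖ := by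
  rw [gradient, LinearIsometryEquiv.norm_map]

/-- A ball of measure larger than `|D|` cannot lie in `D`, and the required radius does not depend
on the centre. The hypothesis `d ≥ 1` makes the measure of the whole space infinite. -/
theorem IsMorreyDomain.exists_notMem_dist_le (h : IsMorreyDomain D p) :
    ∃ R : ℝ, 0 < R ∧ ∀ x : EuclideanSpace ℝ (Fin d), ∃ y ∉ D, dist x y ≤ R := by
  have : Nonempty (Fin d) := ⟨⟨0, h.one_le_dim⟩⟩
  have h1 : ⨆ n : ℕ, volume (Metric.ball (0 : EuclideanSpace ℝ (Fin d)) n) = ⊤ := by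
    rw [← Monotone.measure_iUnion, Metric.iUnion_ball_nat, measure_univ_of_isAddLeftInvariant]
    exact fun m n hmn => Metric.ball_subset_ball (by exact_mod_cast hmn)
  have h2 : volume D < ⨆ n : ℕ, volume (Metric.ball (0 : EuclideanSpace ℝ (Fin d)) n) := by
    rw [h1]; exact h.measure_lt_top
  obtain ⟨n, hn⟩ := lt_iSup_iff.1 h2
  refine ⟨n, ?_, fun x => ?_⟩
  · rcases Nat.eq_zero_or_pos n with rfl | hn'
    · simp at hn
    · exact_mod_cast hn'
  · rw [← Measure.addHaar_ball_center volume x] at hn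
    obtain ⟨y, hy, hyD⟩ := not_subset.1 fun hs => (measure_mono hs).not_gt hn
    exact ⟨y, hyD, by rw [dist_comm]; exact (Metric.mem_ball.1 hy).le⟩

variable [Fact (1 ≤ p)]

theorem rpow_lintegral_fderiv_eq (hp : p ≠ ⊤) {φ : EuclideanSpace ℝ (Fin d) → ℝ}
    {g : Lp (EuclideanSpace ℝ (Fin d)) p (volume : Measure (EuclideanSpace ℝ (Fin d)))}
    (hg : g =ᵐ[volume] gradient φ) :
    (∫⁻ x, ‖fderiv ℝ φ x‖ₑ ^ p.toReal) ^ (1 / p.toReal) = ENNReal.ofReal ‖g‖ := by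
  have hp0 : p ≠ 0 := (zero_lt_one.trans_le (Fact.out : 1 ≤ p)).ne'
  rw [Lp.norm_def, ENNReal.ofReal_toReal (Lp.eLpNorm_ne_top g), eLpNorm_congr_ae hg,
    eLpNorm_eq_lintegral_rpow_enorm_toReal hp0 hp]
  congr 1
  refine lintegral_congr fun x => ?_
  rw [← ofReal_norm, ← ofReal_norm, norm_gradient]

/-- Hölder and sup bounds for test functions. -/
theorem IsMorreyDomain.exists_test_bound (h : IsMorreyDomain D p) :
    ∃ C : ℝ, 0 ≤ C ∧ ∀ (φ : EuclideanSpace ℝ (Fin d) → ℝ)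
      (g : Lp (EuclideanSpace ℝ (Fin d)) p (volume : Measure (EuclideanSpace ℝ (Fin d)))),
      ContDiff ℝ 1 φ → tsupport φ ⊆ D → g =ᵐ[volume] gradient φ →
      (∀ x y, |φ x - φ y| ≤ C * dist x y ^ (1 - (d : ℝ) / p.toReal) * ‖g‖) ∧
        ∀ x, |φ x| ≤ C * ‖g‖ := by
  have hdq : (Module.finrank ℝ (EuclideanSpace ℝ (Fin d)) : ℝ) < p.toReal := by
    simpa using h.dim_lt_toReal
  obtain ⟨C, hC, hM⟩ := exists_morrey_const (volume : Measure (EuclideanSpace ℝ (Fin d)))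
    h.one_lt hdq
  simp only [finrank_euclideanSpace, Fintype.card_fin] at hM
  obtain ⟨R, hR0, hR⟩ := h.exists_notMem_dist_le
  set α := 1 - (d : ℝ) / p.toReal with hα
  have hα0 : 0 < α := h.exponent_pos
  have key : ∀ (φ : EuclideanSpace ℝ (Fin d) → ℝ)
      (g : Lp (EuclideanSpace ℝ (Fin d)) p (volume : Measure (EuclideanSpace ℝ (Fin d)))),
      ContDiff ℝ 1 φ → g =ᵐ[volume] gradient φ →
      ∀ x y, |φ x - φ y| ≤ C.toReal * dist x y ^ α * ‖g‖ := by
    intro φ g hφ hg x y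
    have h1 := hM φ hφ x y
    rw [rpow_lintegral_fderiv_eq h.ne_top hg] at h1
    have h2 := ENNReal.toReal_mono (ENNReal.mul_ne_top (ENNReal.mul_ne_top hC
      ENNReal.ofReal_ne_top) ENNReal.ofReal_ne_top) h1
    rwa [ENNReal.toReal_mul, ENNReal.toReal_mul, ENNReal.toReal_ofReal (by positivity),
      ENNReal.toReal_ofReal (norm_nonneg _), toReal_enorm, Real.norm_eq_abs] at h2
  have hC0 : 0 ≤ C.toReal := ENNReal.toReal_nonneg
  -- The second constant gives the sup bound: some point within distance `R` lies outside `D`, where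
  -- `φ` vanishes.
  refine ⟨max C.toReal (C.toReal * R ^ α), le_max_of_le_left hC0, fun φ g hφ hs hg => ⟨?_, ?_⟩⟩
  · intro x y
    refine (key φ g hφ hg x y).trans ?_
    gcongr
    exact le_max_left _ _
  · intro x
    obtain ⟨y, hy, hxy⟩ := hR x
    have hy0 : φ y = 0 := image_eq_zero_of_notMem_tsupport fun hy' => hy (hs hy')
    have h1 := key φ g hφ hg x y
    rw [hy0, sub_zero] at h1
    refine h1.trans ?_
    gcongr
    refine le_trans ?_ (le_max_right _ _)
    gcongr

/-- The gradient component of an element of `W_0^{1,p}(D)` as an element of `L^p`. -/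
noncomputable def sobolevGradLp : SobolevZero D p →L[ℝ]
    Lp (EuclideanSpace ℝ (Fin d)) p (volume : Measure (EuclideanSpace ℝ (Fin d))) :=
  (ContinuousLinearMap.snd ℝ _ _).comp (SobolevZero D p).subtypeL

/-- The function component of an element of `W_0^{1,p}(D)` as an element of `L^p`. -/
noncomputable def sobolevValLp : SobolevZero D p →L[ℝ]
    Lp ℝ p (volume : Measure (EuclideanSpace ℝ (Fin d))) :=
  (ContinuousLinearMap.fst ℝ _ _).comp (SobolevZero D p).subtypeL

theorem SobolevZero.ext' {u v : SobolevZero D p} (h1 : sobolevValLp u = sobolevValLp v)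
    (h2 : sobolevGradLp u = sobolevGradLp v) : u = v :=
  Subtype.ext (Prod.ext h1 h2)

theorem SobolevZero.norm_le {u : SobolevZero D p} {a : ℝ} (h1 : ‖sobolevValLp u‖ ≤ a)
    (h2 : ‖sobolevGradLp u‖ ≤ a) : ‖u‖ ≤ a :=
  max_le h1 h2

/-- `φ` is a sequence of test functions on `D` converging in `W_0^{1,p}(D)` to `u` and uniformly
to `v`. -/
structure IsTestApprox (u : SobolevZero D p) (v : EuclideanSpace ℝ (Fin d) → ℝ)
    (φ : ℕ → EuclideanSpace ℝ (Fin d) → ℝ) (w : ℕ → SobolevZero D p) : Prop where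
  contDiff : ∀ n, ContDiff ℝ ∞ (φ n)
  hasCompactSupport : ∀ n, HasCompactSupport (φ n)
  tsupport_subset : ∀ n, tsupport (φ n) ⊆ D
  val_eq : ∀ n, sobolevValLp (w n) =ᵐ[volume] φ n
  grad_eq : ∀ n, sobolevGradLp (w n) =ᵐ[volume] gradient (φ n)
  tendsto : Tendsto w atTop (𝓝 u)
  tendstoUniformly : TendstoUniformly φ v atTop

/-- The sup bound applied to differences of test functions makes a sequence that is Cauchy in the
Sobolev norm uniformly Cauchy as well. -/
theorem IsMorreyDomain.exists_isTestApprox (h : IsMorreyDomain D p) (u : SobolevZero D p) :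
    ∃ v φ w, IsTestApprox u v φ w := by
  obtain ⟨C, hC, hb⟩ := h.exists_test_bound
  obtain ⟨w', hw', hlim⟩ := mem_closure_iff_seq_limit.1 u.2
  choose φ h1 h2 h3 h4 h5 using hw'
  let w : ℕ → SobolevZero D p := fun n => ⟨w' n, subset_closure
    ⟨φ n, h1 n, h2 n, h3 n, h4 n, h5 n⟩⟩
  have hw : Tendsto w atTop (𝓝 u) := tendsto_subtype_rng.2 hlim
  have hdiff : ∀ m n x, |φ m x - φ n x| ≤ C * ‖w m - w n‖ := by
    intro m n x
    have hs : tsupport (φ m - φ n) ⊆ D := by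
      rw [sub_eq_add_neg]
      refine (tsupport_add _ _).trans (union_subset (h3 m) ?_)
      have : tsupport (-φ n) = tsupport (φ n) := by simp [tsupport]
      rw [this]; exact h3 n
    have hg : ((w' m).2 - (w' n).2 : Lp _ p volume) =ᵐ[volume] gradient (φ m - φ n) := by
      refine (Lp.coeFn_sub _ _).trans (((h5 m).sub (h5 n)).trans (Eventually.of_forall ?_))
      intro y
      have d1 : DifferentiableAt ℝ (φ m) y := (h1 m).differentiable (by simp) y
      have d2 : DifferentiableAt ℝ (φ n) y := (h1 n).differentiable (by simp) y
      simp [gradient, fderiv_sub d1 d2]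
    refine ((hb (φ m - φ n) _ (((h1 m).sub (h1 n)).of_le (by simp)) hs hg).2 x).trans ?_
    gcongr
    exact le_max_right _ _
  have hcau : ∀ x, CauchySeq fun n => φ n x := by
    intro x
    rw [cauchySeq_iff_tendsto_dist_atTop_0]
    have h0 := cauchySeq_iff_tendsto_dist_atTop_0.1 hw.cauchySeq
    refine squeeze_zero (fun _ => dist_nonneg) (fun n => ?_) (by simpa using h0.const_mul C)
    rw [Real.dist_eq, dist_eq_norm]
    exact hdiff _ _ _
  choose v hv using fun x => cauchySeq_tendsto_of_complete (hcau x)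
  refine ⟨v, φ, w, h1, h2, h3, h4, h5, hw, ?_⟩
  have hlim' : ∀ n x, |v x - φ n x| ≤ C * ‖u - w n‖ := fun n x =>
    le_of_tendsto_of_tendsto' ((hv x).sub_const _).abs ((hw.sub_const _).norm.const_mul C)
      fun m => hdiff m n x
  rw [Metric.tendstoUniformly_iff]
  intro ε hε
  have h0 : Tendsto (fun n => C * ‖u - w n‖) atTop (𝓝 0) := by
    have h6 := ((tendsto_const_nhds (x := u)).sub hw).norm.const_mul C
    rwa [sub_self, norm_zero, mul_zero] at h6
  filter_upwards [h0.eventually (gt_mem_nhds hε)] with n hn x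
  exact (hlim' n x).trans_lt hn

theorem IsTestApprox.continuous {u : SobolevZero D p} {v φ w} (h : IsTestApprox u v φ w) :
    Continuous v :=
  h.tendstoUniformly.continuous (Frequently.of_forall fun n => (h.contDiff n).continuous)

theorem Lp.ae_eq_of_tendsto {α F : Type*} [MeasurableSpace α] {μ : Measure α}
    [NormedAddCommGroup F] {w : ℕ → Lp F p μ} {u : Lp F p μ} (hw : Tendsto w atTop (𝓝 u))
    {φ : ℕ → α → F} (hφ : ∀ n, w n =ᵐ[μ] φ n) {v : α → F}
    (hv : ∀ᵐ x ∂μ, Tendsto (fun n => φ n x) atTop (𝓝 (v x))) : u =ᵐ[μ] v := by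
  obtain ⟨ns, hns, hae⟩ := (tendstoInMeasure_of_tendsto_Lp hw).exists_seq_tendsto_ae
  filter_upwards [hae, hv, ae_all_iff.2 hφ] with x h1 h2 h3
  refine tendsto_nhds_unique h1 ?_
  simp only [h3]
  exact h2.comp hns.tendsto_atTop

theorem IsTestApprox.ae_eq {u : SobolevZero D p} {v φ w} (h : IsTestApprox u v φ w) :
    sobolevVal u =ᵐ[volume] v :=
  Lp.ae_eq_of_tendsto ((sobolevValLp.continuous.tendsto u).comp h.tendsto) h.val_eq
    (Eventually.of_forall fun x => h.tendstoUniformly.tendsto_at x)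

open Classical in
/-- The continuous representative of a function (zero if there is none). -/
noncomputable def continuousRep (u : EuclideanSpace ℝ (Fin d) → ℝ) : EuclideanSpace ℝ (Fin d) → ℝ :=
  if h : ∃ v : EuclideanSpace ℝ (Fin d) → ℝ, Continuous v ∧ v =ᵐ[volume] u then h.choose else 0

theorem continuousRep_eq {u v : EuclideanSpace ℝ (Fin d) → ℝ} (hv : Continuous v)
    (h : v =ᵐ[volume] u) : continuousRep u = v := by
  have hex : ∃ v : EuclideanSpace ℝ (Fin d) → ℝ, Continuous v ∧ v =ᵐ[volume] u := ⟨v, hv, h⟩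
  rw [continuousRep, dif_pos hex]
  exact (Continuous.ae_eq_iff_eq volume hex.choose_spec.1 hv).1 (hex.choose_spec.2.trans h.symm)

theorem VanishesOn.continuousRep_eq_zero {u : EuclideanSpace ℝ (Fin d) → ℝ}
    {S : Set (EuclideanSpace ℝ (Fin d))} (h : VanishesOn u S) :
    ∀ x ∈ S, continuousRep u x = 0 := by
  obtain ⟨v, hv, hvu, h0⟩ := h
  rw [continuousRep_eq hv hvu]; exact h0

theorem IsMorreyDomain.exists_isTestApprox_rep (h : IsMorreyDomain D p) (u : SobolevZero D p) :
    ∃ φ w, IsTestApprox u (continuousRep (sobolevVal u)) φ w := by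
  obtain ⟨v, φ, w, ha⟩ := h.exists_isTestApprox u
  rw [continuousRep_eq ha.continuous ha.ae_eq.symm]
  exact ⟨φ, w, ha⟩

theorem IsMorreyDomain.continuous_rep (h : IsMorreyDomain D p) (u : SobolevZero D p) :
    Continuous (continuousRep (sobolevVal u)) := by
  obtain ⟨φ, w, ha⟩ := h.exists_isTestApprox_rep u
  exact ha.continuous

theorem IsMorreyDomain.rep_ae_eq (h : IsMorreyDomain D p) (u : SobolevZero D p) :
    continuousRep (sobolevVal u) =ᵐ[volume] sobolevVal u := by
  obtain ⟨φ, w, ha⟩ := h.exists_isTestApprox_rep u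
  exact ha.ae_eq.symm

theorem IsMorreyDomain.vanishesOn_iff (h : IsMorreyDomain D p) {u : SobolevZero D p}
    {S : Set (EuclideanSpace ℝ (Fin d))} :
    VanishesOn (sobolevVal u) S ↔ ∀ x ∈ S, continuousRep (sobolevVal u) x = 0 :=
  ⟨fun hv => hv.continuousRep_eq_zero, fun hv => ⟨_, h.continuous_rep u, h.rep_ae_eq u, hv⟩⟩

theorem IsMorreyDomain.rep_add (h : IsMorreyDomain D p) (u v : SobolevZero D p) :
    continuousRep (sobolevVal (u + v)) =
      continuousRep (sobolevVal u) + continuousRep (sobolevVal v) :=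
  continuousRep_eq ((h.continuous_rep u).add (h.continuous_rep v))
    (((h.rep_ae_eq u).add (h.rep_ae_eq v)).trans
      (Lp.coeFn_add (sobolevValLp u) (sobolevValLp v)).symm)

theorem IsMorreyDomain.rep_smul (h : IsMorreyDomain D p) (c : ℝ) (u : SobolevZero D p) :
    continuousRep (sobolevVal (c • u)) = c • continuousRep (sobolevVal u) :=
  continuousRep_eq ((h.continuous_rep u).const_smul c)
    (((h.rep_ae_eq u).const_smul c).trans (Lp.coeFn_smul c (sobolevValLp u)).symm)

/-- Pointwise limits of functions supported in `D` vanish off `D`. Hence vanishing on `D \ Ω`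
amounts to vanishing off `Ω`. -/
theorem IsMorreyDomain.rep_eq_zero (h : IsMorreyDomain D p) (u : SobolevZero D p)
    {x : EuclideanSpace ℝ (Fin d)} (hx : x ∉ D) : continuousRep (sobolevVal u) x = 0 := by
  obtain ⟨φ, w, ha⟩ := h.exists_isTestApprox_rep u
  refine tendsto_nhds_unique (ha.tendstoUniformly.tendsto_at x) ?_
  have : (fun n => φ n x) = fun _ => 0 := funext fun n =>
    image_eq_zero_of_notMem_tsupport fun h' => hx (ha.tsupport_subset n h')
  rw [this]
  exact tendsto_const_nhds

/-- A test function uniformly within `ε` of the representative is nonzero on this closed set, which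
therefore lies in its compact support. -/
theorem IsMorreyDomain.isCompact_le_abs_rep (h : IsMorreyDomain D p) (u : SobolevZero D p)
    {ε : ℝ} (hε : 0 < ε) : IsCompact {x | ε ≤ |continuousRep (sobolevVal u) x|} := by
  obtain ⟨φ, w, ha⟩ := h.exists_isTestApprox_rep u
  obtain ⟨n, hn⟩ := (Metric.tendstoUniformly_iff.1 ha.tendstoUniformly ε hε).exists
  refine (ha.hasCompactSupport n).isCompact.of_isClosed_subset
    (isClosed_le continuous_const ha.continuous.abs) fun x hx => ?_
  by_contra hxs
  have h1 := hn x
  rw [image_eq_zero_of_notMem_tsupport hxs, dist_zero_right, Real.norm_eq_abs] at h1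
  exact (lt_irrefl _ (h1.trans_le hx))

/-- **Morrey's embedding**: Hölder and sup bounds for the continuous representative. -/
theorem IsMorreyDomain.exists_rep_bound (h : IsMorreyDomain D p) :
    ∃ C : ℝ, 0 ≤ C ∧ ∀ u : SobolevZero D p,
      (∀ x y, |continuousRep (sobolevVal u) x - continuousRep (sobolevVal u) y| ≤
        C * dist x y ^ (1 - (d : ℝ) / p.toReal) * ‖sobolevGradLp u‖) ∧
      ∀ x, |continuousRep (sobolevVal u) x| ≤ C * ‖sobolevGradLp u‖ := by
  obtain ⟨C, hC, hb⟩ := h.exists_test_bound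
  refine ⟨C, hC, fun u => ?_⟩
  obtain ⟨φ, w, ha⟩ := h.exists_isTestApprox_rep u
  have h1 := fun n => hb (φ n) (sobolevGradLp (w n)) ((ha.contDiff n).of_le (by simp))
    (ha.tsupport_subset n) (ha.grad_eq n)
  have h2 : Tendsto (fun n => ‖sobolevGradLp (w n)‖) atTop (𝓝 ‖sobolevGradLp u‖) :=
    ((sobolevGradLp.continuous.tendsto u).comp ha.tendsto).norm
  have h3 := ha.tendstoUniformly.tendsto_at
  refine ⟨fun x y => le_of_tendsto_of_tendsto' ((h3 x).sub (h3 y)).abs (h2.const_mul _)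
    fun n => (h1 n).1 x y, fun x => le_of_tendsto_of_tendsto' (h3 x).abs (h2.const_mul _)
    fun n => (h1 n).2 x⟩

/-- **Poincaré's inequality** on `W_0^{1,p}(D)`. -/
theorem IsMorreyDomain.exists_norm_le_grad (h : IsMorreyDomain D p) :
    ∃ C : ℝ, 0 ≤ C ∧ ∀ u : SobolevZero D p, ‖u‖ ≤ C * ‖sobolevGradLp u‖ := by
  obtain ⟨C, hC, hb⟩ := h.exists_rep_bound
  set A := volume D ^ p.toReal⁻¹ with hA
  have hAt : A ≠ ⊤ :=
    ENNReal.rpow_ne_top_of_nonneg (inv_nonneg.2 ENNReal.toReal_nonneg) h.measure_lt_top.ne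
  -- The norm is a maximum of two components: 1 serves the gradient, and the sup bound times
  -- `|D|^(1/p)` serves the function.
  refine ⟨max 1 (A.toReal * C), le_max_of_le_left zero_le_one, fun u =>
    SobolevZero.norm_le ?_ ?_⟩
  · have h1 : eLpNorm (sobolevVal u) p volume ≤ A * ENNReal.ofReal (C * ‖sobolevGradLp u‖) := by
      rw [← eLpNorm_congr_ae (h.rep_ae_eq u),
        ← eLpNorm_restrict_eq_of_support_subset (s := D)]
      · refine (eLpNorm_le_of_ae_bound (Eventually.of_forall (hb u).2)).trans_eq ?_
        rw [Measure.restrict_apply_univ]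
      · exact fun x hx => by_contra fun hxD => hx (h.rep_eq_zero u hxD)
    have h2 := ENNReal.toReal_mono (ENNReal.mul_ne_top hAt ENNReal.ofReal_ne_top) h1
    rw [ENNReal.toReal_mul, ENNReal.toReal_ofReal (by positivity), ← mul_assoc] at h2
    rw [Lp.norm_def]
    refine h2.trans ?_
    gcongr
    exact le_max_right _ _
  · exact le_mul_of_one_le_left (norm_nonneg _) (le_max_left _ _)

/-- Used to replace the integral over `D` in the energy by the full `L^p` norm of the gradient. -/
theorem IsMorreyDomain.grad_ae_eq_zero (h : IsMorreyDomain D p) (u : SobolevZero D p) :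
    ∀ᵐ x ∂volume, x ∉ D → sobolevGrad u x = 0 := by
  obtain ⟨φ, w, ha⟩ := h.exists_isTestApprox_rep u
  obtain ⟨ns, -, hae⟩ := (tendstoInMeasure_of_tendsto_Lp
    ((sobolevGradLp.continuous.tendsto u).comp ha.tendsto)).exists_seq_tendsto_ae
  filter_upwards [hae, ae_all_iff.2 ha.grad_eq] with x h1 h2 hx
  refine tendsto_nhds_unique h1 ?_
  have h3 : ∀ n, gradient (φ n) x = 0 := fun n => by
    have : fderiv ℝ (φ n) x = 0 := image_eq_zero_of_notMem_tsupport fun h' =>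
      hx (ha.tsupport_subset n (tsupport_fderiv_subset ℝ h'))
    rw [gradient, this, map_zero]
  simp [h2, h3]

end ContinuousRepresentative

/-! ### Chain rule, uniqueness of the gradient, and truncation. -/

section ChainRule

open Set Filter Topology

/-- Dominated convergence with majorant `(2C|g|)^p`. The multipliers need to converge only
pointwise, so their limit may be discontinuous. -/
theorem Lp.exists_tendsto_smul_of_bounded {α F : Type*} [MeasurableSpace α] {μ : Measure α}
    [NormedAddCommGroup F] [NormedSpace ℝ F] {p : ℝ≥0∞} [Fact (1 ≤ p)] (hp : p ≠ ⊤)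
    (g : Lp F p μ) {c : ℕ → α → ℝ} {c₀ : α → ℝ} {C : ℝ}
    (hc : ∀ n, AEStronglyMeasurable (c n) μ) (hC : ∀ n x, |c n x| ≤ C)
    (hlim : ∀ x, Tendsto (fun n => c n x) atTop (𝓝 (c₀ x)))
    {w : ℕ → Lp F p μ} (hw : ∀ n, w n =ᵐ[μ] fun x => c n x • g x) :
    ∃ l : Lp F p μ, l =ᵐ[μ] (fun x => c₀ x • g x) ∧ Tendsto w atTop (𝓝 l) := by
  have hp1 : 1 ≤ p := Fact.out
  have hp0 : p ≠ 0 := (zero_lt_one.trans_le hp1).ne'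
  have hq : 0 < p.toReal := ENNReal.toReal_pos hp0 hp
  have hC₀ : ∀ x, |c₀ x| ≤ C := fun x => le_of_tendsto' (hlim x).abs fun n => hC n x
  have hc₀ : AEStronglyMeasurable c₀ μ :=
    aestronglyMeasurable_of_tendsto_ae atTop hc (Eventually.of_forall hlim)
  have hmem : MemLp (fun x => c₀ x • g x) p μ := by
    refine (Lp.memLp g).of_le_mul (c := C) (hc₀.smul (Lp.aestronglyMeasurable g))
      (Eventually.of_forall fun x => ?_)
    rw [norm_smul]
    gcongr
    exact hC₀ x
  refine ⟨hmem.toLp _, hmem.coeFn_toLp, Lp.tendsto_Lp_of_tendsto_eLpNorm _ hmem ?_⟩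
  have h1 : ∀ n, eLpNorm (⇑(w n) - fun x => c₀ x • g x) p μ =
      (∫⁻ x, ‖(c n x - c₀ x) • g x‖ₑ ^ p.toReal ∂μ) ^ (1 / p.toReal) := by
    intro n
    rw [← eLpNorm_eq_lintegral_rpow_enorm_toReal hp0 hp]
    refine eLpNorm_congr_ae ?_
    filter_upwards [hw n] with x hx
    rw [Pi.sub_apply, hx, sub_smul]
  simp only [h1]
  have h2 : Tendsto (fun n => ∫⁻ x, ‖(c n x - c₀ x) • g x‖ₑ ^ p.toReal ∂μ) atTop
      (𝓝 (∫⁻ _, 0 ∂μ)) := by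
    refine tendsto_lintegral_of_dominated_convergence'
      (fun x => (ENNReal.ofReal (2 * C) * ‖g x‖ₑ) ^ p.toReal) (fun n => ?_) (fun n => ?_) ?_ ?_
    · exact (((hc n).sub hc₀).smul (Lp.aestronglyMeasurable g)).enorm.pow_const _
    · refine Eventually.of_forall fun x => ?_
      have h3 : |c n x - c₀ x| ≤ 2 * C :=
        (abs_sub _ _).trans (by linarith [hC n x, hC₀ x])
      dsimp only
      rw [enorm_smul]
      gcongr
      rw [← ofReal_norm]
      exact ENNReal.ofReal_le_ofReal h3
    · simp only [ENNReal.mul_rpow_of_nonneg _ _ hq.le]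
      rw [lintegral_const_mul' _ _ (by finiteness)]
      refine ENNReal.mul_ne_top (by finiteness) ?_
      exact (lintegral_rpow_enorm_lt_top_of_eLpNorm_lt_top hp0 hp (Lp.eLpNorm_lt_top g)).ne
    · refine Eventually.of_forall fun x => ?_
      have h3 : Tendsto (fun n => (c n x - c₀ x) • g x) atTop (𝓝 0) := by
        simpa using ((hlim x).sub_const (c₀ x)).smul_const (g x)
      have h4 := (h3.enorm).ennrpow_const p.toReal
      simpa [hq] using h4
  rw [lintegral_zero] at h2
  simpa [hq] using h2.ennrpow_const (1 / p.toReal)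

theorem Lp.norm_sub_le_mul_of_ae {α F G : Type*} [MeasurableSpace α] {μ : Measure α}
    [NormedAddCommGroup F] [NormedAddCommGroup G] {p : ℝ≥0∞} {a b : Lp F p μ} {a' b' : Lp G p μ}
    {C : ℝ} (h : ∀ᵐ x ∂μ, ‖a x - b x‖ ≤ C * ‖a' x - b' x‖) : ‖a - b‖ ≤ C * ‖a' - b'‖ := by
  refine Lp.norm_le_mul_norm_of_ae_le_mul ?_
  filter_upwards [h, Lp.coeFn_sub a b, Lp.coeFn_sub a' b'] with x h0 h1 h2
  rwa [h1, h2]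

variable {d : ℕ} {p : ℝ≥0∞} {D : Set (EuclideanSpace ℝ (Fin d))} [Fact (1 ≤ p)]

theorem gradient_comp {G : ℝ → ℝ} (hG : Differentiable ℝ G)
    {φ : EuclideanSpace ℝ (Fin d) → ℝ} (hφ : Differentiable ℝ φ) (x : EuclideanSpace ℝ (Fin d)) :
    gradient (fun x => G (φ x)) x = deriv G (φ x) • gradient φ x := by
  have h1 : HasFDerivAt (fun x => G (φ x)) (deriv G (φ x) • fderiv ℝ φ x) x :=
    (hG (φ x)).hasDerivAt.comp_hasFDerivAt x (hφ x).hasFDerivAt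
  rw [gradient, gradient, h1.fderiv, map_smul]

set_option maxHeartbeats 800000 in
/-- Chain rule in `W_0^{1,p}(D)`. -/
theorem IsMorreyDomain.exists_comp (h : IsMorreyDomain D p) (u : SobolevZero D p)
    {G : ℝ → ℝ} (hG : ContDiff ℝ ∞ G) (hG0 : G 0 = 0) {C : ℝ} (hC : ∀ s, |deriv G s| ≤ C) :
    ∃ w : SobolevZero D p,
      sobolevValLp w =ᵐ[volume] (fun x => G (continuousRep (sobolevVal u) x)) ∧
      sobolevGradLp w =ᵐ[volume]
        fun x => deriv G (continuousRep (sobolevVal u) x) • sobolevGrad u x := by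
  obtain ⟨φ, w, ha⟩ := h.exists_isTestApprox_rep u
  set v := continuousRep (sobolevVal u) with hv
  have hGd : Differentiable ℝ G := hG.differentiable (by simp)
  have hG' : Continuous (deriv G) := hG.continuous_deriv (by simp)
  have hlip : ∀ a b, |G a - G b| ≤ C * |a - b| := fun a b =>
    Convex.norm_image_sub_le_of_norm_deriv_le (fun x _ => hGd x) (fun x _ => hC x) convex_univ
      (mem_univ b) (mem_univ a)
  have hφd : ∀ n, Differentiable ℝ (φ n) := fun n => (ha.contDiff n).differentiable (by simp)
  have hφc : ∀ n, Continuous (φ n) := fun n => (ha.contDiff n).continuous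
  have hu1 : sobolevValLp u =ᵐ[volume] v := ha.ae_eq
  have hm1 : ∀ n, MemLp (fun x => G (φ n x)) p volume := by
    intro n
    refine (Lp.memLp (sobolevValLp (w n))).of_le_mul (c := C)
      (hG.continuous.comp (hφc n)).aestronglyMeasurable ?_
    filter_upwards [ha.val_eq n] with x hx
    simpa [hG0, hx] using hlip (φ n x) 0
  have hm2 : ∀ n, MemLp (fun x => deriv G (φ n x) • sobolevGradLp (w n) x) p volume := by
    intro n
    refine (Lp.memLp (sobolevGradLp (w n))).of_le_mul (c := C)
      ((hG'.comp (hφc n)).aestronglyMeasurable.smul (Lp.aestronglyMeasurable _))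
      (Eventually.of_forall fun x => ?_)
    rw [norm_smul]
    gcongr
    exact hC _
  have hml : MemLp (fun x => G (v x)) p volume := by
    refine (Lp.memLp (sobolevValLp u)).of_le_mul (c := C)
      (hG.continuous.comp ha.continuous).aestronglyMeasurable ?_
    filter_upwards [hu1] with x hx
    simpa [hG0, hx] using hlip (v x) 0
  have hm3 : ∀ n, MemLp (fun x => deriv G (φ n x) • sobolevGradLp u x) p volume := by
    intro n
    refine (Lp.memLp (sobolevGradLp u)).of_le_mul (c := C)
      ((hG'.comp (hφc n)).aestronglyMeasurable.smul (Lp.aestronglyMeasurable _))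
      (Eventually.of_forall fun x => ?_)
    rw [norm_smul]
    gcongr
    exact hC _
  obtain ⟨A, hA⟩ : ∃ A : ℕ → Lp ℝ p volume, ∀ n, A n =ᵐ[volume] fun x => G (φ n x) :=
    ⟨fun n => (hm1 n).toLp, fun n => (hm1 n).coeFn_toLp⟩
  obtain ⟨a, ha'⟩ : ∃ a : Lp ℝ p volume, a =ᵐ[volume] fun x => G (v x) :=
    ⟨hml.toLp, hml.coeFn_toLp⟩
  obtain ⟨B, hB⟩ : ∃ B : ℕ → Lp (EuclideanSpace ℝ (Fin d)) p volume,
      ∀ n, B n =ᵐ[volume] fun x => deriv G (φ n x) • sobolevGradLp (w n) x :=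
    ⟨fun n => (hm2 n).toLp, fun n => (hm2 n).coeFn_toLp⟩
  -- Intermediate sequence: `B - B'` tends to 0 because `G'` is bounded and the gradients converge
  -- in `L^p`, while `B'` converges because only its bounded multiplier varies.
  obtain ⟨B', hB'⟩ : ∃ B : ℕ → Lp (EuclideanSpace ℝ (Fin d)) p volume,
      ∀ n, B n =ᵐ[volume] fun x => deriv G (φ n x) • sobolevGradLp u x :=
    ⟨fun n => (hm3 n).toLp, fun n => (hm3 n).coeFn_toLp⟩
  have t1 : Tendsto A atTop (𝓝 a) := by
    rw [tendsto_iff_norm_sub_tendsto_zero]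
    have h0 : Tendsto (fun n => C * ‖sobolevValLp (w n) - sobolevValLp u‖) atTop (𝓝 0) := by
      simpa using (tendsto_iff_norm_sub_tendsto_zero.1
        ((sobolevValLp.continuous.tendsto u).comp ha.tendsto)).const_mul C
    refine squeeze_zero (fun _ => norm_nonneg _) (fun n => ?_) h0
    refine Lp.norm_sub_le_mul_of_ae ?_
    filter_upwards [hA n, ha', ha.val_eq n, hu1] with x e2 e3 e5 e6
    rw [e2, e3, e5, e6]
    exact hlip _ _
  obtain ⟨l, hl, hlim⟩ := Lp.exists_tendsto_smul_of_bounded h.ne_top (sobolevGradLp u)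
    (c := fun n x => deriv G (φ n x)) (c₀ := fun x => deriv G (v x))
    (fun n => (hG'.comp (hφc n)).aestronglyMeasurable) (fun n x => hC _)
    (fun x => (hG'.tendsto _).comp (ha.tendstoUniformly.tendsto_at x))
    hB'
  have t2 : Tendsto B atTop (𝓝 l) := by
    refine (hlim.congr_dist ?_)
    simp only [dist_eq_norm]
    have h0 : Tendsto (fun n => C * ‖sobolevGradLp (w n) - sobolevGradLp u‖) atTop (𝓝 0) := by
      simpa using (tendsto_iff_norm_sub_tendsto_zero.1
        ((sobolevGradLp.continuous.tendsto u).comp ha.tendsto)).const_mul C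
    refine squeeze_zero (fun _ => norm_nonneg _) (fun n => ?_) h0
    rw [norm_sub_rev]
    refine Lp.norm_sub_le_mul_of_ae ?_
    filter_upwards [hB n, hB' n] with x e2 e3
    rw [e2, e3, ← smul_sub, norm_smul]
    gcongr
    exact hC _
  have hmem : (a, l) ∈
      SobolevZero D p := by
    refine mem_closure_of_tendsto (t1.prodMk_nhds t2) (Eventually.of_forall fun n => ?_)
    refine ⟨fun x => G (φ n x), hG.comp (ha.contDiff n), (ha.hasCompactSupport n).comp_left hG0,
      (closure_mono (Function.support_comp_subset hG0 _)).trans (ha.tsupport_subset n),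
      hA n, ?_⟩
    filter_upwards [hB n, ha.grad_eq n] with x e1 e2
    rw [e1, gradient_comp hGd (hφd n), e2]
  exact ⟨⟨_, hmem⟩, ha', hl⟩

/-- Integration by parts in `W_0^{1,p}(D)`; in particular the gradient is determined by the
function. -/
theorem integral_inner_sobolevGrad (u : SobolevZero D p)
    {ψ : EuclideanSpace ℝ (Fin d) → ℝ} (hψ : ContDiff ℝ ∞ ψ) (hψc : HasCompactSupport ψ)
    (e : EuclideanSpace ℝ (Fin d)) :
    ∫ x, inner ℝ (ψ x • e) (sobolevGrad u x) = -∫ x, fderiv ℝ ψ x e * sobolevVal u x := by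
  have hp1 : 1 ≤ p := Fact.out
  have hconj : p.conjExponent.HolderConjugate p := (ENNReal.HolderConjugate.conjExponent hp1).symm
  have hq1 : Fact (1 ≤ p.conjExponent) := ⟨ENNReal.HolderConjugate.one_le _ p⟩
  have hψd : Differentiable ℝ ψ := hψ.differentiable (by simp)
  have c1 : Continuous fun x => ψ x • e := hψ.continuous.smul continuous_const
  have c2 : Continuous fun x => fderiv ℝ ψ x e :=
    (hψ.continuous_fderiv (by simp)).clm_apply continuous_const
  have m1 : MemLp (fun x => ψ x • e) p.conjExponent volume :=
    c1.memLp_of_hasCompactSupport hψc.smul_right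
  have m2 : MemLp (fun x => fderiv ℝ ψ x e) p.conjExponent volume :=
    c2.memLp_of_hasCompactSupport (hψc.fderiv_apply ℝ e)
  let L1 := (innerSL ℝ (E := EuclideanSpace ℝ (Fin d))).lpPairing volume p.conjExponent p m1.toLp
  let L2 := (ContinuousLinearMap.mul ℝ ℝ).lpPairing volume p.conjExponent p m2.toLp
  have e1 : ∀ g : Lp (EuclideanSpace ℝ (Fin d)) p volume,
      L1 g = ∫ x, inner ℝ (ψ x • e) (g x) := by
    intro g
    rw [ContinuousLinearMap.lpPairing_eq_integral]
    refine integral_congr_ae ?_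
    filter_upwards [m1.coeFn_toLp] with x hx
    rw [hx, innerSL_apply_apply]
  have e2 : ∀ g : Lp ℝ p volume, L2 g = ∫ x, fderiv ℝ ψ x e * g x := by
    intro g
    rw [ContinuousLinearMap.lpPairing_eq_integral]
    refine integral_congr_ae ?_
    filter_upwards [m2.coeFn_toLp] with x hx
    rw [hx, ContinuousLinearMap.mul_apply']
  -- Both sides are continuous in the pair, so the identity extends from test pairs to their
  -- closure.
  have hcl : IsClosed {w : Lp ℝ p volume × Lp (EuclideanSpace ℝ (Fin d)) p volume |
      L1 w.2 = -L2 w.1} :=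
    isClosed_eq (L1.continuous.comp continuous_snd) (L2.continuous.comp continuous_fst).neg
  have hsub : ((testPairs D p : Submodule ℝ _) : Set _) ⊆
      {w : Lp ℝ p volume × Lp (EuclideanSpace ℝ (Fin d)) p volume | L1 w.2 = -L2 w.1} := by
    rintro w ⟨φ, h1, h2, h3, h4, h5⟩
    have hφd : Differentiable ℝ φ := h1.differentiable (by simp)
    have i1 : Continuous fun x => fderiv ℝ φ x e :=
      (h1.continuous_fderiv (by simp)).clm_apply continuous_const
    show L1 w.2 = -L2 w.1
    rw [e1, e2]
    have a1 : ∫ x, inner ℝ (ψ x • e) (w.2 x) = ∫ x, ψ x * fderiv ℝ φ x e := by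
      refine integral_congr_ae ?_
      filter_upwards [h5] with x hx
      rw [hx, real_inner_smul_left, real_inner_comm, gradient, InnerProductSpace.toDual_symm_apply]
    have a2 : ∫ x, fderiv ℝ ψ x e * w.1 x = ∫ x, fderiv ℝ ψ x e * φ x := by
      refine integral_congr_ae ?_
      filter_upwards [h4] with x hx
      rw [hx]
    rw [a1, a2]
    exact integral_mul_fderiv_eq_neg_fderiv_mul_of_integrable
      ((c2.mul h1.continuous).integrable_of_hasCompactSupport h2.mul_left)
      ((hψ.continuous.mul i1).integrable_of_hasCompactSupport hψc.mul_right)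
      ((hψ.continuous.mul h1.continuous).integrable_of_hasCompactSupport hψc.mul_right)
      (fun x _ => hψd x) (fun x _ => hφd x)
  have hu := closure_minimal hsub hcl u.2
  have hu' : L1 (sobolevGradLp u) = -L2 (sobolevValLp u) := hu
  rw [e1, e2] at hu'
  exact hu'

/-- If the function component is zero, integration by parts shows that each component of the
gradient integrates to zero against every test function. -/
theorem SobolevZero.ext_val {u v : SobolevZero D p}
    (huv : sobolevValLp u = sobolevValLp v) : u = v := by
  refine SobolevZero.ext' huv ?_
  rw [← sub_eq_zero, ← map_sub]
  set w := u - v with hw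
  have hw0 : sobolevVal w =ᵐ[volume] 0 := by
    have : sobolevValLp w = 0 := by rw [hw, map_sub, huv, sub_self]
    change ⇑(sobolevValLp w) =ᵐ[volume] 0
    rw [this]
    exact Lp.coeFn_zero ..
  have hcoord : ∀ i : Fin d, ∀ᵐ x ∂volume, sobolevGrad w x i = 0 := by
    intro i
    have hloc : LocallyIntegrable (fun x => sobolevGrad w x i) volume := by
      have h1 : LocallyIntegrable (sobolevGrad w) volume :=
        (Lp.memLp (sobolevGradLp w)).locallyIntegrable Fact.out
      intro x
      obtain ⟨s, hs, hi⟩ := h1 x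
      exact ⟨s, hs, (EuclideanSpace.proj (𝕜 := ℝ) i).integrable_comp hi⟩
    refine ae_eq_zero_of_integral_contDiff_smul_eq_zero hloc fun ψ hψ hψc => ?_
    have h1 := integral_inner_sobolevGrad w hψ hψc (EuclideanSpace.single i (1 : ℝ))
    have h2 : ∫ x, fderiv ℝ ψ x (EuclideanSpace.single i (1 : ℝ)) * sobolevVal w x = 0 := by
      rw [← integral_zero (EuclideanSpace ℝ (Fin d)) ℝ]
      refine integral_congr_ae ?_
      filter_upwards [hw0] with x hx
      rw [hx]; simp
    rw [h2, neg_zero] at h1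
    rw [← h1]
    refine integral_congr_ae (Eventually.of_forall fun x => ?_)
    simp [real_inner_smul_left, EuclideanSpace.inner_single_left]
  refine Lp.ext ?_
  filter_upwards [ae_all_iff.2 hcoord, Lp.coeFn_zero (EuclideanSpace ℝ (Fin d)) p volume]
    with x hx h0
  rw [h0]
  exact PiLp.ext hx

/-- A smooth truncation of the identity near the origin. -/
theorem exists_smooth_truncation : ∃ (T η : ℝ → ℝ) (C : ℝ), ContDiff ℝ ∞ T ∧ Continuous η ∧
    (∀ s, T s = η s * s) ∧ (∀ s, |η s| ≤ 1) ∧ (∀ s, |deriv T s| ≤ C) ∧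
    (∀ s, |s| ≤ 1 → T s = 0) ∧ (η 0 = 0) ∧ (deriv T 0 = 0) ∧
    (∀ s, 2 < |s| → η s = 1) ∧ (∀ s, 2 < |s| → deriv T s = 1) := by
  -- This factor is 0 for `s² ≤ 1` and 1 for `s² ≥ 2`.
  have hη : ContDiff ℝ ∞ fun s : ℝ => Real.smoothTransition (s ^ 2 - 1) :=
    Real.smoothTransition.contDiff.comp (by fun_prop)
  have hT : ContDiff ℝ ∞ fun s : ℝ => Real.smoothTransition (s ^ 2 - 1) * s :=
    hη.mul contDiff_id
  have hη1 : ∀ s : ℝ, 2 < |s| → Real.smoothTransition (s ^ 2 - 1) = 1 := by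
    intro s hs
    refine Real.smoothTransition.one_of_one_le ?_
    nlinarith [sq_abs s]
  have h0 : ∀ s : ℝ, |s| ≤ 1 → Real.smoothTransition (s ^ 2 - 1) = 0 := by
    intro s hs
    refine Real.smoothTransition.zero_of_nonpos ?_
    nlinarith [sq_abs s, abs_nonneg s]
  have hd1 : ∀ s : ℝ, 2 < |s| →
      deriv (fun s : ℝ => Real.smoothTransition (s ^ 2 - 1) * s) s = 1 := by
    intro s hs
    have hopen : {s : ℝ | 2 < |s|} ∈ 𝓝 s :=
      (isOpen_lt continuous_const continuous_abs).mem_nhds hs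
    have : (fun s : ℝ => Real.smoothTransition (s ^ 2 - 1) * s) =ᶠ[𝓝 s] id := by
      filter_upwards [hopen] with t ht
      rw [hη1 t ht, one_mul, id]
    rw [this.deriv_eq, deriv_id]
  obtain ⟨C, hC⟩ := (isCompact_Icc (a := (-2 : ℝ)) (b := 2)).exists_bound_of_continuousOn
    (hT.continuous_deriv (by simp)).continuousOn
  refine ⟨fun s => Real.smoothTransition (s ^ 2 - 1) * s,
    fun s => Real.smoothTransition (s ^ 2 - 1), max C 1, hT, hη.continuous, fun s => rfl, ?_, ?_,
    fun s hs => by simp [h0 s hs], h0 0 (by simp), ?_, hη1, hd1⟩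
  · intro s
    rw [abs_of_nonneg (Real.smoothTransition.nonneg _)]
    exact Real.smoothTransition.le_one _
  · intro s
    rcases le_or_gt |s| 2 with hs | hs
    · exact (hC s (abs_le.1 hs)).trans (le_max_left _ _)
    · rw [hd1 s hs, abs_one]; exact le_max_right _ _
  · have hopen : {s : ℝ | |s| < 1} ∈ 𝓝 (0 : ℝ) :=
      (isOpen_lt continuous_abs continuous_const).mem_nhds (by simp)
    have : (fun s : ℝ => Real.smoothTransition (s ^ 2 - 1) * s) =ᶠ[𝓝 0] fun _ => 0 := by
      filter_upwards [hopen] with t ht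
      rw [h0 t (le_of_lt ht), zero_mul]
    rw [this.deriv_eq, deriv_const]

/-- Applied to both `η` and `T'`, so the functions and the gradients of the truncations acquire the
same limiting multiplier. -/
theorem tendsto_comp_mul_natCast {F : ℝ → ℝ} (h0 : F 0 = 0) (h1 : ∀ s, 2 < |s| → F s = 1)
    (s : ℝ) : Tendsto (fun n : ℕ => F (((n : ℝ) + 1) * s)) atTop
      (𝓝 (({0}ᶜ : Set ℝ).indicator 1 s)) := by
  rcases eq_or_ne s 0 with rfl | hs
  · simp [h0]
  · rw [indicator_of_mem (by simpa using hs), Pi.one_apply]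
    refine tendsto_const_nhds.congr' ?_
    obtain ⟨N, hN⟩ := exists_nat_gt (2 / |s|)
    filter_upwards [eventually_ge_atTop N] with n hn
    refine (h1 _ ?_).symm
    have hs' : 0 < |s| := abs_pos.2 hs
    rw [div_lt_iff₀ hs'] at hN
    have hn' : (N : ℝ) ≤ n := by exact_mod_cast hn
    rw [abs_mul, abs_of_pos (by positivity)]
    nlinarith

/-- Every element of `W_0^{1,p}(D)` is a limit of elements vanishing where it is small. -/
theorem IsMorreyDomain.exists_truncation (h : IsMorreyDomain D p) (u : SobolevZero D p) :
    ∃ w : ℕ → SobolevZero D p, Tendsto w atTop (𝓝 u) ∧ ∀ n, ∃ ε > 0, ∀ x,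
      |continuousRep (sobolevVal u) x| ≤ ε → continuousRep (sobolevVal (w n)) x = 0 := by
  obtain ⟨T, η, C, hT, hη, hTη, hη1, hC, hT0, hη0, hT'0, hηlim, hTlim⟩ := exists_smooth_truncation
  set v := continuousRep (sobolevVal u) with hv
  have hvc : Continuous v := h.continuous_rep u
  have hvu : sobolevValLp u =ᵐ[volume] v := (h.rep_ae_eq u).symm
  have hpos : ∀ n : ℕ, (0 : ℝ) < n + 1 := fun n => by positivity
  -- The rescaled truncations vanish for `|s| ≤ 1/(n+1)`, and their derivatives `T'((n+1)s)` keep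
  -- the bound `C`.
  have hG : ∀ n : ℕ, ContDiff ℝ ∞ fun s => ((n : ℝ) + 1)⁻¹ * T (((n : ℝ) + 1) * s) := fun n =>
    contDiff_const.mul (hT.comp (contDiff_const.mul contDiff_id))
  have hG' : ∀ (n : ℕ) (s : ℝ), deriv (fun s => ((n : ℝ) + 1)⁻¹ * T (((n : ℝ) + 1) * s)) s =
      deriv T (((n : ℝ) + 1) * s) := by
    intro n s
    have h1 : HasDerivAt (fun s => ((n : ℝ) + 1)⁻¹ * T (((n : ℝ) + 1) * s))
        (((n : ℝ) + 1)⁻¹ * (deriv T (((n : ℝ) + 1) * s) * (((n : ℝ) + 1) * 1))) s :=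
      (((hT.differentiable (by simp) _).hasDerivAt).comp s
        ((hasDerivAt_id s).const_mul ((n : ℝ) + 1))).const_mul _
    rw [h1.deriv]
    field_simp [(hpos n).ne']
  choose w hw1 hw2 using fun n : ℕ => h.exists_comp u (hG n) (by simp [hT0 0 (by simp)])
    (C := C) (fun s => by rw [hG']; exact hC _)
  have hT'c : Continuous (deriv T) := hT.continuous_deriv (by simp)
  obtain ⟨l₁, hl₁, t₁⟩ := Lp.exists_tendsto_smul_of_bounded h.ne_top (sobolevValLp u)
    (c := fun (n : ℕ) x => η (((n : ℝ) + 1) * v x))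
    (c₀ := fun x => ({0}ᶜ : Set ℝ).indicator 1 (v x)) (C := 1)
    (fun n => (hη.comp (continuous_const.mul hvc)).aestronglyMeasurable) (fun n x => hη1 _)
    (fun x => tendsto_comp_mul_natCast hη0 hηlim _) (w := fun n => sobolevValLp (w n)) (by
      intro n
      filter_upwards [hw1 n, hvu] with x e1 e2
      rw [e1, e2, hTη, smul_eq_mul, ← hv]
      field_simp [(hpos n).ne'])
  obtain ⟨l₂, hl₂, t₂⟩ := Lp.exists_tendsto_smul_of_bounded h.ne_top (sobolevGradLp u)
    (c := fun (n : ℕ) x => deriv T (((n : ℝ) + 1) * v x))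
    (c₀ := fun x => ({0}ᶜ : Set ℝ).indicator 1 (v x)) (C := C)
    (fun n => (hT'c.comp (continuous_const.mul hvc)).aestronglyMeasurable) (fun n x => hC _)
    (fun x => tendsto_comp_mul_natCast hT'0 hTlim _) (w := fun n => sobolevGradLp (w n)) (by
      intro n
      filter_upwards [hw2 n] with x e1
      rw [e1, hG']
      rfl)
  have tw : Tendsto (fun n => (w n : Lp ℝ p volume × Lp (EuclideanSpace ℝ (Fin d)) p volume))
      atTop (𝓝 (l₁, l₂)) := t₁.prodMk_nhds t₂
  have hmem : (l₁, l₂) ∈ SobolevZero D p :=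
    (testPairs D p).isClosed_topologicalClosure.mem_of_tendsto tw
      (Eventually.of_forall fun n => (w n).2)
  -- The gradient limit is `∇u` multiplied by the indicator of `{v ≠ 0}`. That it equals `∇u` needs
  -- no separate argument: the function components agree, and they determine the gradients.
  have hl : (⟨(l₁, l₂), hmem⟩ : SobolevZero D p) = u := by
    refine SobolevZero.ext_val (Lp.ext ?_)
    refine EventuallyEq.trans hl₁ ?_
    filter_upwards [hvu] with x hx
    rw [hx]
    by_cases h0 : v x = 0 <;> simp [h0]
  refine ⟨w, ?_, fun n => ⟨((n : ℝ) + 1)⁻¹, by positivity, fun x hx => ?_⟩⟩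
  · rw [← hl]
    exact tendsto_subtype_rng.2 tw
  · have hrep : continuousRep (sobolevVal (w n)) = _ :=
      continuousRep_eq ((hG n).continuous.comp hvc) (hw1 n).symm
    rw [hrep]
    have : |((n : ℝ) + 1) * v x| ≤ 1 := by
      rw [abs_mul, abs_of_pos (hpos n)]
      calc ((n : ℝ) + 1) * |v x| ≤ ((n : ℝ) + 1) * ((n : ℝ) + 1)⁻¹ := by gcongr
        _ = 1 := mul_inv_cancel₀ (hpos n).ne'
    simp [hT0 _ this]

end ChainRule

/-! ### Quantitative strict convexity of the `p`-th power of the norm. -/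

section UniformConvexity

open Set Filter Topology

variable {F : Type*} [NormedAddCommGroup F] [NormedSpace ℝ F] [StrictConvexSpace ℝ F]

/-- For equal norms, strictness comes from strict convexity of the norm; for different norms, from
that of `t ↦ t^q`. -/
theorem norm_midpoint_rpow_lt {q : ℝ} (hq : 1 < q) {a b : F} (hab : a ≠ b) :
    ‖(1 / 2 : ℝ) • (a + b)‖ ^ q < (‖a‖ ^ q + ‖b‖ ^ q) / 2 := by
  have hq0 : 0 < q := by linarith
  have h1 : ‖(1 / 2 : ℝ) • (a + b)‖ = 1 / 2 * ‖a + b‖ := by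
    rw [norm_smul]; norm_num
  by_cases hn : ‖a‖ = ‖b‖
  · have h2 : ‖a + b‖ < ‖a‖ + ‖b‖ := by
      refine lt_of_le_of_ne (norm_add_le _ _) fun h => hab ?_
      exact (sameRay_iff_norm_add.2 h).eq_of_norm_eq hn
    have h3 : ‖(1 / 2 : ℝ) • (a + b)‖ < ‖a‖ := by rw [h1]; linarith
    calc ‖(1 / 2 : ℝ) • (a + b)‖ ^ q < ‖a‖ ^ q := Real.rpow_lt_rpow (norm_nonneg _) h3 hq0
      _ = (‖a‖ ^ q + ‖b‖ ^ q) / 2 := by rw [← hn]; ring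
  · have h2 := (strictConvexOn_rpow hq).2 (mem_Ici.2 (norm_nonneg a)) (mem_Ici.2 (norm_nonneg b))
      hn one_half_pos one_half_pos (add_halves 1)
    simp only [smul_eq_mul] at h2
    calc ‖(1 / 2 : ℝ) • (a + b)‖ ^ q ≤ (1 / 2 * ‖a‖ + 1 / 2 * ‖b‖) ^ q := by
          refine Real.rpow_le_rpow (norm_nonneg _) ?_ hq0.le
          rw [h1]; linarith [norm_add_le a b]
      _ < _ := by linarith

/-- Quantitative strict convexity of `‖·‖ ^ q` on a finite-dimensional strictly convex space. -/
theorem exists_norm_sub_rpow_le [FiniteDimensional ℝ F] {q : ℝ} (hq : 1 < q) {ε : ℝ} (hε : 0 < ε) :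
    ∃ C : ℝ, 0 ≤ C ∧ ∀ a b : F, ‖a - b‖ ^ q ≤ ε * (‖a‖ ^ q + ‖b‖ ^ q) +
      C * ((‖a‖ ^ q + ‖b‖ ^ q) / 2 - ‖(1 / 2 : ℝ) • (a + b)‖ ^ q) := by
  have hq0 : 0 < q := by linarith
  have hprop : ProperSpace F := FiniteDimensional.proper ℝ F
  have hcont : ∀ {X : Type _} [TopologicalSpace X] {h : X → F}, Continuous h →
      Continuous fun x => ‖h x‖ ^ q := fun hh => hh.norm.rpow_const fun _ => Or.inr hq0.le
  have hc1 : Continuous fun z : F × F => ‖z.1‖ ^ q + ‖z.2‖ ^ q :=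
    (hcont continuous_fst).add (hcont continuous_snd)
  have hc2 : Continuous fun z : F × F => ‖z.1 - z.2‖ ^ q := hcont (by fun_prop)
  have hc3 : Continuous fun z : F × F => ‖(1 / 2 : ℝ) • (z.1 + z.2)‖ ^ q := hcont (by fun_prop)
  -- By homogeneity it suffices to treat normalized pairs. Either `‖a - b‖^q < ε`, absorbed by the
  -- first term, or the pair lies in the compact set `K`, where the midpoint gap has a positive
  -- minimum `δ`.
  set K : Set (F × F) := {z | ‖z.1‖ ^ q + ‖z.2‖ ^ q = 1 ∧ ε ≤ ‖z.1 - z.2‖ ^ q} with hK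
  have hle1 : ∀ {x y : F}, ‖x‖ ^ q + ‖y‖ ^ q = 1 → ‖x‖ ≤ 1 := by
    intro x y hxy
    by_contra hx
    have := Real.one_lt_rpow (not_le.1 hx) hq0
    have := Real.rpow_nonneg (norm_nonneg y) q
    linarith
  have hle2 : ∀ {x y : F}, ‖x‖ ^ q + ‖y‖ ^ q = 1 → ‖x - y‖ ^ q ≤ 2 ^ q := by
    intro x y hxy
    refine Real.rpow_le_rpow (norm_nonneg _) ?_ hq0.le
    have h1 := hle1 hxy
    have h2 := hle1 ((add_comm _ _).trans hxy)
    linarith [norm_sub_le x y]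
  have hKc : IsCompact K := by
    refine ((isCompact_closedBall (0 : F) 1).prod (isCompact_closedBall (0 : F) 1)).of_isClosed_subset
      ((isClosed_eq hc1 continuous_const).inter (isClosed_le continuous_const hc2)) ?_
    rintro ⟨x, y⟩ ⟨h1, -⟩
    exact ⟨by simpa using hle1 h1, by simpa using hle1 ((add_comm _ _).trans h1)⟩
  obtain ⟨δ, hδ, hδK⟩ : ∃ δ > 0, ∀ z ∈ K,
      δ ≤ (‖z.1‖ ^ q + ‖z.2‖ ^ q) / 2 - ‖(1 / 2 : ℝ) • (z.1 + z.2)‖ ^ q := by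
    rcases K.eq_empty_or_nonempty with h0 | h0
    · exact ⟨1, one_pos, by simp [h0]⟩
    · obtain ⟨z, hz, hmin⟩ := hKc.exists_isMinOn h0 ((hc1.div_const 2).sub hc3).continuousOn
      refine ⟨_, sub_pos.2 (norm_midpoint_rpow_lt hq fun hzz => ?_), fun y hy => hmin hy⟩
      have := hz.2
      rw [hzz, sub_self, norm_zero, Real.zero_rpow hq0.ne'] at this
      exact hε.not_ge this
  have hnonneg : ∀ a b : F, 0 ≤ (‖a‖ ^ q + ‖b‖ ^ q) / 2 - ‖(1 / 2 : ℝ) • (a + b)‖ ^ q := by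
    intro a b
    rcases eq_or_ne a b with rfl | hab
    · rw [← two_smul ℝ a, smul_smul]; norm_num
    · exact (sub_pos.2 (norm_midpoint_rpow_lt hq hab)).le
  -- On `K` the left side is at most `2^q` and the gap at least `δ`.
  refine ⟨2 ^ q / δ, by positivity, fun a b => ?_⟩
  set s := ‖a‖ ^ q + ‖b‖ ^ q with hs
  have ha0 := Real.rpow_nonneg (norm_nonneg a) q
  have hb0 := Real.rpow_nonneg (norm_nonneg b) q
  have hs0 : 0 ≤ s := add_nonneg ha0 hb0
  rcases hs0.eq_or_lt with h0 | h0
  · have ha : a = 0 := by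
      have : ‖a‖ ^ q = 0 := by linarith
      simpa using (Real.rpow_eq_zero (norm_nonneg a) hq0.ne').1 this
    have hb : b = 0 := by
      have : ‖b‖ ^ q = 0 := by linarith
      simpa using (Real.rpow_eq_zero (norm_nonneg b) hq0.ne').1 this
    simp [hs, ha, hb, Real.zero_rpow hq0.ne']
  · set t := s ^ (1 / q) with ht
    have ht0 : 0 < t := Real.rpow_pos_of_pos h0 _
    have htq : t ^ q = s := by
      rw [ht, ← Real.rpow_mul hs0, one_div_mul_cancel hq0.ne', Real.rpow_one]
    have hscale : ∀ c : F, ‖t⁻¹ • c‖ ^ q = ‖c‖ ^ q / s := by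
      intro c
      rw [norm_smul, Real.norm_of_nonneg (inv_nonneg.2 ht0.le),
        Real.mul_rpow (inv_nonneg.2 ht0.le) (norm_nonneg _), Real.inv_rpow ht0.le, htq]
      ring
    have h1 : ‖t⁻¹ • a‖ ^ q + ‖t⁻¹ • b‖ ^ q = 1 := by
      rw [hscale, hscale, ← add_div, ← hs, div_self h0.ne']
    by_cases hab : ε ≤ ‖t⁻¹ • a - t⁻¹ • b‖ ^ q
    · have h2 := hδK (t⁻¹ • a, t⁻¹ • b) ⟨h1, hab⟩
      have h3 := hle2 h1
      dsimp only at h2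
      rw [h1, ← smul_add, smul_comm, hscale] at h2
      rw [← smul_sub, hscale, div_le_iff₀ h0] at h3
      have h4 : δ * s ≤ s / 2 - ‖(1 / 2 : ℝ) • (a + b)‖ ^ q := by
        have := mul_le_mul_of_nonneg_right h2 hs0
        rw [sub_mul, div_mul_cancel₀ _ h0.ne'] at this
        linarith
      have h5 : 2 ^ q * s ≤ 2 ^ q / δ * (s / 2 - ‖(1 / 2 : ℝ) • (a + b)‖ ^ q) := by
        calc (2 : ℝ) ^ q * s = 2 ^ q / δ * (δ * s) := by field_simp
          _ ≤ _ := by gcongr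
      have h6 : 0 ≤ ε * s := by positivity
      linarith
    · rw [not_le, ← smul_sub, hscale, div_lt_iff₀ h0] at hab
      have h5 : 0 ≤ 2 ^ q / δ * (s / 2 - ‖(1 / 2 : ℝ) • (a + b)‖ ^ q) :=
        mul_nonneg (by positivity) (hnonneg a b)
      linarith

theorem Lp.norm_rpow_eq_integral {α G : Type*} [MeasurableSpace α] {μ : Measure α}
    [NormedAddCommGroup G] {p : ℝ≥0∞} (hp0 : p ≠ 0) (hp : p ≠ ⊤) (g : Lp G p μ) :
    ‖g‖ ^ p.toReal = ∫ x, ‖g x‖ ^ p.toReal ∂μ := by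
  have hq : 0 < p.toReal := ENNReal.toReal_pos hp0 hp
  have h0 : 0 ≤ ∫ x, ‖g x‖ ^ p.toReal ∂μ := integral_nonneg fun x => by positivity
  rw [Lp.norm_def, (Lp.memLp g).eLpNorm_eq_integral_rpow_norm hp0 hp,
    ENNReal.toReal_ofReal (by positivity), ← Real.rpow_mul h0, inv_mul_cancel₀ hq.ne', Real.rpow_one]

/-- The pointwise inequality integrates term by term. This takes the place of Clarkson's
inequalities. -/
theorem Lp.exists_norm_sub_rpow_le {α : Type*} [MeasurableSpace α] {μ : Measure α}
    [FiniteDimensional ℝ F] {p : ℝ≥0∞} [Fact (1 ≤ p)] (hp : p ≠ ⊤) (hq : 1 < p.toReal)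
    {ε : ℝ} (hε : 0 < ε) :
    ∃ C : ℝ, 0 ≤ C ∧ ∀ a b : Lp F p μ, ‖a - b‖ ^ p.toReal ≤
      ε * (‖a‖ ^ p.toReal + ‖b‖ ^ p.toReal) +
      C * ((‖a‖ ^ p.toReal + ‖b‖ ^ p.toReal) / 2 - ‖(1 / 2 : ℝ) • (a + b)‖ ^ p.toReal) := by
  have hp0 : p ≠ 0 := (zero_lt_one.trans_le (Fact.out : 1 ≤ p)).ne'
  obtain ⟨C, hC, hb⟩ := _root_.exists_norm_sub_rpow_le (F := F) hq hε
  refine ⟨C, hC, fun a b => ?_⟩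
  have hi : ∀ g : Lp F p μ, Integrable (fun x => ‖g x‖ ^ p.toReal) μ := fun g =>
    (Lp.memLp g).integrable_norm_rpow hp0 hp
  simp only [Lp.norm_rpow_eq_integral hp0 hp]
  have hab : Integrable (fun x => ‖a x‖ ^ p.toReal + ‖b x‖ ^ p.toReal) μ := (hi a).add (hi b)
  have hd : Integrable (fun x => (‖a x‖ ^ p.toReal + ‖b x‖ ^ p.toReal) / 2 -
      ‖((1 / 2 : ℝ) • (a + b)) x‖ ^ p.toReal) μ := (hab.div_const 2).sub (hi _)
  rw [← integral_add (hi a) (hi b), ← integral_const_mul, ← integral_div,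
    ← integral_sub (hab.div_const 2) (hi _), ← integral_const_mul,
    ← integral_add (hab.const_mul ε) (hd.const_mul C)]
  refine integral_mono_ae (hi _) ((hab.const_mul ε).add (hd.const_mul C)) ?_
  filter_upwards [Lp.coeFn_sub a b, Lp.coeFn_smul (1 / 2 : ℝ) (a + b), Lp.coeFn_add a b]
    with x e1 e2 e3
  rw [e1, Pi.sub_apply]
  simp only [Pi.add_apply, e2, Pi.smul_apply, e3]
  exact hb (a x) (b x)

end UniformConvexity

/-! ### Coercivity of the energy and convergence of minimizing sequences. -/

section Energy

open Set Filter Topology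

variable {d : ℕ} {p : ℝ≥0∞} {D : Set (EuclideanSpace ℝ (Fin d))} [Fact (1 ≤ p)]

theorem IsMorreyDomain.pEnergy_eq (h : IsMorreyDomain D p) (f : SobolevZero D p →L[ℝ] ℝ)
    (u : SobolevZero D p) :
    pEnergy f u = 1 / p.toReal * ‖sobolevGradLp u‖ ^ p.toReal - f u := by
  have hp0 : p ≠ 0 := (zero_lt_one.trans_le (Fact.out : 1 ≤ p)).ne'
  have hq : p.toReal ≠ 0 := (zero_lt_one.trans h.one_lt).ne'
  rw [pEnergy, integral_const_mul, Lp.norm_rpow_eq_integral hp0 h.ne_top]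
  congr 2
  rw [setIntegral_eq_integral_of_ae_compl_eq_zero]
  · rfl
  · filter_upwards [h.grad_ae_eq_zero u] with x hx hxD
    rw [hx hxD, norm_zero, Real.zero_rpow hq]

theorem IsMorreyDomain.continuous_pEnergy (h : IsMorreyDomain D p)
    (f : SobolevZero D p →L[ℝ] ℝ) : Continuous (pEnergy f) := by
  have hq : 0 ≤ p.toReal := ENNReal.toReal_nonneg
  rw [funext (h.pEnergy_eq f)]
  exact (continuous_const.mul (sobolevGradLp.continuous.norm.rpow_const fun _ => Or.inr hq)).sub
    f.continuous

/-- The linear term `f` cancels in the midpoint gap. -/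
theorem IsMorreyDomain.pEnergy_midpoint (h : IsMorreyDomain D p)
    (f : SobolevZero D p →L[ℝ] ℝ) (u v : SobolevZero D p) :
    (‖sobolevGradLp u‖ ^ p.toReal + ‖sobolevGradLp v‖ ^ p.toReal) / 2 -
        ‖(1 / 2 : ℝ) • (sobolevGradLp u + sobolevGradLp v)‖ ^ p.toReal =
      p.toReal * ((pEnergy f u + pEnergy f v) / 2 - pEnergy f ((1 / 2 : ℝ) • (u + v))) := by
  have hq : p.toReal ≠ 0 := (zero_lt_one.trans h.one_lt).ne'
  simp only [h.pEnergy_eq, map_smul, map_add, smul_eq_mul]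
  field_simp
  ring

theorem exists_le_of_rpow_sub_mul_le {q : ℝ} (hq : 1 < q) (c B : ℝ) :
    ∃ M : ℝ, 0 ≤ M ∧ ∀ t : ℝ, 0 ≤ t → 1 / q * t ^ q - c * t ≤ B → t ≤ M := by
  have hq0 : 0 < q := by linarith
  have h1 : Tendsto (fun t : ℝ => t * (1 / q * t ^ (q - 1) - c)) atTop atTop :=
    tendsto_id.atTop_mul_atTop₀ (tendsto_atTop_add_const_right _ (-c)
      ((tendsto_rpow_atTop (by linarith)).const_mul_atTop (by positivity)))
  obtain ⟨M, hM⟩ := eventually_atTop.1 (h1.eventually_gt_atTop B)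
  refine ⟨max M 0, le_max_right _ _, fun t ht hle => ?_⟩
  by_contra! hlt
  have ht0 : 0 < t := (le_max_right _ _).trans_lt hlt
  have h2 := hM t ((le_max_left _ _).trans hlt.le)
  have h3 : t ^ q = t * t ^ (q - 1) := by
    rw [Real.rpow_sub_one ht0.ne']; field_simp
  rw [h3] at hle
  linarith

theorem IsMorreyDomain.exists_grad_le (h : IsMorreyDomain D p) (f : SobolevZero D p →L[ℝ] ℝ)
    (B : ℝ) : ∃ M : ℝ, 0 ≤ M ∧ ∀ u, pEnergy f u ≤ B → ‖sobolevGradLp u‖ ≤ M := by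
  obtain ⟨C, hC, hP⟩ := h.exists_norm_le_grad
  obtain ⟨M, hM0, hM⟩ := exists_le_of_rpow_sub_mul_le h.one_lt (‖f‖ * C) B
  refine ⟨M, hM0, fun u hu => hM _ (norm_nonneg _) (le_trans ?_ hu)⟩
  rw [h.pEnergy_eq]
  have h1 : f u ≤ ‖f‖ * (C * ‖sobolevGradLp u‖) := (le_abs_self _).trans
    ((f.le_opNorm u).trans (by gcongr; exact hP u))
  linarith

/-- Only elements of nonpositive energy matter; coercivity bounds their gradients, and hence the
linear term. -/
theorem IsMorreyDomain.exists_le_pEnergy (h : IsMorreyDomain D p)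
    (f : SobolevZero D p →L[ℝ] ℝ) : ∃ b : ℝ, ∀ u, b ≤ pEnergy f u := by
  obtain ⟨C, hC, hP⟩ := h.exists_norm_le_grad
  obtain ⟨M, hM0, hM⟩ := h.exists_grad_le f 0
  refine ⟨-(‖f‖ * (C * M)), fun u => ?_⟩
  rcases le_or_gt (pEnergy f u) 0 with hu | hu
  · have h1 : f u ≤ ‖f‖ * (C * M) := (le_abs_self _).trans
      ((f.le_opNorm u).trans (by gcongr; exact (hP u).trans (by gcongr; exact hM u hu)))
    have h2 : 0 ≤ 1 / p.toReal * ‖sobolevGradLp u‖ ^ p.toReal := by positivity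
    rw [h.pEnergy_eq]
    linarith
  · have : 0 ≤ ‖f‖ * (C * M) := by positivity
    linarith

set_option maxHeartbeats 800000 in
theorem IsMorreyDomain.norm_grad_sub_rpow_le (h : IsMorreyDomain D p)
    (f : SobolevZero D p →L[ℝ] ℝ) {ε : ℝ} (hε : 0 < ε) :
    ∃ C : ℝ, 0 ≤ C ∧ ∀ u v : SobolevZero D p, ‖sobolevGradLp (u - v)‖ ^ p.toReal ≤
      ε * (‖sobolevGradLp u‖ ^ p.toReal + ‖sobolevGradLp v‖ ^ p.toReal) +
      C * ((pEnergy f u + pEnergy f v) / 2 - pEnergy f ((1 / 2 : ℝ) • (u + v))) := by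
  obtain ⟨C, hC, hb⟩ := Lp.exists_norm_sub_rpow_le (F := EuclideanSpace ℝ (Fin d))
    (μ := (volume : Measure (EuclideanSpace ℝ (Fin d)))) h.ne_top h.one_lt hε
  have hq : 0 < p.toReal := zero_lt_one.trans h.one_lt
  refine ⟨C * p.toReal, by positivity, fun u v => ?_⟩
  have h1 := hb (sobolevGradLp u) (sobolevGradLp v)
  rw [h.pEnergy_midpoint f, ← mul_assoc] at h1
  rw [map_sub]
  exact h1

/-- Bounded energy bounds the gradients, so the `ε` term of the convexity inequality can be made
small first; the small midpoint gap then controls the `C` term, and Poincaré's inequality passes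
from gradients to the norm. -/
theorem IsMorreyDomain.cauchySeq_of_midpoint (h : IsMorreyDomain D p)
    (f : SobolevZero D p →L[ℝ] ℝ) {u : ℕ → SobolevZero D p} {B : ℝ}
    (hB : ∀ᶠ n in atTop, pEnergy f (u n) ≤ B)
    (hmid : ∀ δ > 0, ∃ N, ∀ m ≥ N, ∀ n ≥ N, (pEnergy f (u m) + pEnergy f (u n)) / 2 -
      pEnergy f ((1 / 2 : ℝ) • (u m + u n)) ≤ δ) : CauchySeq u := by
  have hq : 0 < p.toReal := zero_lt_one.trans h.one_lt
  obtain ⟨M, hM0, hM⟩ := h.exists_grad_le f B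
  obtain ⟨P, hP0, hP⟩ := h.exists_norm_le_grad
  obtain ⟨N₀, hN₀⟩ := eventually_atTop.1 hB
  rw [Metric.cauchySeq_iff]
  intro η hη
  set τ : ℝ := (η / (P + 1)) ^ p.toReal with hτ
  have hτ0 : 0 < τ := by positivity
  have hMq : 0 ≤ M ^ p.toReal := by positivity
  -- These choices make the two terms at most `τ/2` and `τ/4`; each `+ 1` avoids a zero denominator.
  obtain ⟨C, hC, hb⟩ := h.norm_grad_sub_rpow_le f
    (ε := τ / (4 * (M ^ p.toReal + 1))) (by positivity)
  obtain ⟨N, hN⟩ := hmid (τ / (4 * (C + 1))) (by positivity)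
  refine ⟨max N₀ N, fun m hm n hn => ?_⟩
  have bm : ‖sobolevGradLp (u m)‖ ^ p.toReal ≤ M ^ p.toReal :=
    Real.rpow_le_rpow (norm_nonneg _) (hM _ (hN₀ m ((le_max_left _ _).trans hm))) hq.le
  have bn : ‖sobolevGradLp (u n)‖ ^ p.toReal ≤ M ^ p.toReal :=
    Real.rpow_le_rpow (norm_nonneg _) (hM _ (hN₀ n ((le_max_left _ _).trans hn))) hq.le
  have hmn := hN m ((le_max_right _ _).trans hm) n ((le_max_right _ _).trans hn)
  have h1 : ‖sobolevGradLp (u m - u n)‖ ^ p.toReal < τ := by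
    refine (hb (u m) (u n)).trans_lt ?_
    calc _ ≤ τ / (4 * (M ^ p.toReal + 1)) * (M ^ p.toReal + M ^ p.toReal) +
          C * (τ / (4 * (C + 1))) := by gcongr
      _ = τ / 2 * (M ^ p.toReal / (M ^ p.toReal + 1)) + τ / 4 * (C / (C + 1)) := by
          field_simp; ring
      _ ≤ τ / 2 * 1 + τ / 4 * 1 := by
          gcongr
          · rw [div_le_one (by positivity)]; linarith
          · rw [div_le_one (by positivity)]; linarith
      _ < τ := by linarith
  have h2 : ‖sobolevGradLp (u m - u n)‖ < η / (P + 1) :=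
    (Real.rpow_lt_rpow_iff (norm_nonneg _) (by positivity) hq).1 h1
  rw [dist_eq_norm]
  calc ‖u m - u n‖ ≤ P * ‖sobolevGradLp (u m - u n)‖ := hP _
    _ ≤ (P + 1) * ‖sobolevGradLp (u m - u n)‖ := by gcongr; linarith
    _ < (P + 1) * (η / (P + 1)) := by gcongr
    _ = η := by field_simp

instance : CompleteSpace (SobolevZero D p) :=
  (testPairs D p).isClosed_topologicalClosure.completeSpace_coe

set_option maxHeartbeats 1000000 in
/-- A decreasing sequence of closed convex sets on which the energy does not blow up has a common
point of low energy. -/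
theorem IsMorreyDomain.exists_mem_forall_pEnergy_le (h : IsMorreyDomain D p)
    (f : SobolevZero D p →L[ℝ] ℝ) {F : ℕ → Set (SobolevZero D p)} (hanti : Antitone F)
    (hcl : ∀ n, IsClosed (F n))
    (hmid : ∀ n, ∀ u ∈ F n, ∀ v ∈ F n, (1 / 2 : ℝ) • (u + v) ∈ F n) {B : ℝ}
    (hB : ∀ n, ∀ δ > 0, ∃ u ∈ F n, pEnergy f u ≤ B + δ) :
    ∃ w, (∀ n, w ∈ F n) ∧ pEnergy f w ≤ B := by
  obtain ⟨b, hb⟩ := h.exists_le_pEnergy f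
  have hbdd : ∀ n, BddBelow (pEnergy f '' F n) := fun n => ⟨b, by rintro _ ⟨u, -, rfl⟩; exact hb u⟩
  have hne : ∀ n, (pEnergy f '' F n).Nonempty := fun n =>
    let ⟨u, hu, _⟩ := hB n 1 one_pos; ⟨_, u, hu, rfl⟩
  set e : ℕ → ℝ := fun n => sInf (pEnergy f '' F n) with he
  have hmono : Monotone e := fun m n hmn => csInf_le_csInf (hbdd m) (hne n) (image_mono (hanti hmn))
  have heB : ∀ n, e n ≤ B := fun n => le_of_forall_pos_le_add fun δ hδ => by
    obtain ⟨u, hu, hle⟩ := hB n δ hδ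
    exact (csInf_le (hbdd n) ⟨u, hu, rfl⟩).trans hle
  have hlim : Tendsto e atTop (𝓝 (⨆ n, e n)) :=
    tendsto_atTop_ciSup hmono ⟨B, by rintro _ ⟨n, rfl⟩; exact heB n⟩
  have hle : ∀ n, e n ≤ ⨆ n, e n := fun n => hmono.ge_of_tendsto hlim n
  have hex : ∀ n : ℕ, ∃ u ∈ F n, pEnergy f u < e n + 1 / ((n : ℝ) + 1) := by
    intro n
    have hpos : (0 : ℝ) < 1 / ((n : ℝ) + 1) := by positivity
    obtain ⟨_, ⟨u, hu, rfl⟩, hlt⟩ := exists_lt_of_csInf_lt (hne n) (lt_add_of_pos_right (e n) hpos)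
    exact ⟨u, hu, hlt⟩
  choose u hu hue using hex
  have hone : Tendsto (fun n : ℕ => 1 / ((n : ℝ) + 1)) atTop (𝓝 0) :=
    tendsto_one_div_add_atTop_nhds_zero_nat
  have hcau : CauchySeq u := by
    refine h.cauchySeq_of_midpoint f (B := B + 1) (Eventually.of_forall fun n => ?_) fun δ hδ => ?_
    · have : 1 / ((n : ℝ) + 1) ≤ 1 := by
        rw [div_le_one (by positivity)]; linarith [(Nat.cast_nonneg n : (0 : ℝ) ≤ n)]
      linarith [hue n, heB n]
    -- For `m, n ≥ N` the midpoint lies in `F N`, so its energy is at least `e N`; this bounds the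
    -- gap by the quantity tending to 0 here.
    · have t : Tendsto (fun n => (⨆ k, e k) - e n + 1 / ((n : ℝ) + 1)) atTop (𝓝 0) := by
        simpa using (hlim.const_sub (⨆ k, e k)).add hone
      obtain ⟨N, hN⟩ := (t.eventually (gt_mem_nhds hδ)).exists
      refine ⟨N, fun m hm n hn => ?_⟩
      have h1 : e N ≤ pEnergy f ((1 / 2 : ℝ) • (u m + u n)) :=
        csInf_le (hbdd N) ⟨_, hmid N _ (hanti hm (hu m)) _ (hanti hn (hu n)), rfl⟩
      have h2 : ∀ k ≥ N, pEnergy f (u k) ≤ (⨆ k, e k) + 1 / ((N : ℝ) + 1) := fun k hk => by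
        have h3 := Nat.one_div_le_one_div (α := ℝ) hk
        linarith [hue k, hle k]
      linarith [h2 m hm, h2 n hn]
  obtain ⟨w, hw⟩ := cauchySeq_tendsto_of_complete hcau
  refine ⟨w, fun n => (hcl n).mem_of_tendsto hw ?_, ?_⟩
  · filter_upwards [eventually_ge_atTop n] with k hk
    exact hanti hk (hu k)
  · have h1 : Tendsto (fun n : ℕ => B + 1 / ((n : ℝ) + 1)) atTop (𝓝 B) := by
      simpa using hone.const_add B
    exact le_of_tendsto_of_tendsto' (((h.continuous_pEnergy f).tendsto w).comp hw) h1
      fun n => by linarith [Function.comp_apply (f := pEnergy f) (g := u) (x := n), hue n, heB n]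

/-- The alternating sequence `u, v, u, v, …` has nonpositive midpoint gaps, hence is Cauchy. -/
theorem IsMorreyDomain.eq_of_isMinOn (h : IsMorreyDomain D p) (f : SobolevZero D p →L[ℝ] ℝ)
    {F : Set (SobolevZero D p)} (hmid : ∀ u ∈ F, ∀ v ∈ F, (1 / 2 : ℝ) • (u + v) ∈ F)
    {u v : SobolevZero D p} (hu : u ∈ F) (hv : v ∈ F) (hum : IsMinOn (pEnergy f) F u)
    (hvm : IsMinOn (pEnergy f) F v) : u = v := by
  have h1 : CauchySeq fun n : ℕ => if Even n then u else v := by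
    refine h.cauchySeq_of_midpoint f (B := max (pEnergy f u) (pEnergy f v))
      (Eventually.of_forall fun n => ?_) fun δ hδ => ⟨0, fun m _ n _ => ?_⟩
    · split_ifs <;> simp
    · have key : ∀ a ∈ F, ∀ b ∈ F, IsMinOn (pEnergy f) F a → IsMinOn (pEnergy f) F b →
          (pEnergy f a + pEnergy f b) / 2 - pEnergy f ((1 / 2 : ℝ) • (a + b)) ≤ δ := by
        intro a ha b hb ham hbm
        have h2 := isMinOn_iff.1 ham _ (hmid a ha b hb)
        have h3 := isMinOn_iff.1 hbm _ (hmid a ha b hb)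
        linarith
      split_ifs
      · exact key _ hu _ hu hum hum
      · exact key _ hu _ hv hum hvm
      · exact key _ hv _ hu hvm hum
      · exact key _ hv _ hv hvm hvm
  refine eq_of_forall_dist_le fun ε hε => ?_
  obtain ⟨N, hN⟩ := Metric.cauchySeq_iff.1 h1 ε hε
  have h2 := hN (2 * N) (by linarith) (2 * N + 1) (by linarith)
  simp only [even_two_mul, if_true, Nat.not_even_two_mul_add_one, if_false] at h2
  exact h2.le

end Energy

/-! ### State functions and their continuity under convergence of domains. -/

section States

open Set Filter Topology

/-- The slab `|L| ≤ η` is closed and convex. -/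
theorem abs_apply_le_of_mem_closure_convexHull {E : Type*} [NormedAddCommGroup E]
    [NormedSpace ℝ E] (L : E →L[ℝ] ℝ) {s : Set E} {η : ℝ} (hs : ∀ a ∈ s, |L a| ≤ η) {w : E}
    (hw : w ∈ closure (convexHull ℝ s)) : |L w| ≤ η := by
  have hcl : closure (convexHull ℝ s) ⊆ L ⁻¹' Icc (-η) η :=
    closure_minimal (convexHull_min (fun a ha => abs_le.1 (hs a ha))
      ((convex_Icc _ _).linear_preimage L.toLinearMap)) (isClosed_Icc.preimage L.continuous)
  exact abs_le.2 (hcl hw)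

theorem midpoint_mem_closure_convexHull {E : Type*} [NormedAddCommGroup E]
    [NormedSpace ℝ E] {s : Set E} {a b : E} (ha : a ∈ closure (convexHull ℝ s))
    (hb : b ∈ closure (convexHull ℝ s)) : (1 / 2 : ℝ) • (a + b) ∈ closure (convexHull ℝ s) := by
  rw [smul_add]
  exact (convex_convexHull ℝ _).closure ha hb one_half_pos.le one_half_pos.le (add_halves 1)

variable {d : ℕ} {p : ℝ≥0∞} {D : Set (EuclideanSpace ℝ (Fin d))} [Fact (1 ≤ p)]

theorem isState_iff {f : SobolevZero D p →L[ℝ] ℝ} {Ω : Set (EuclideanSpace ℝ (Fin d))}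
    {u : SobolevZero D p} :
    IsState f Ω u ↔ u ∈ {v : SobolevZero D p | VanishesOn (sobolevVal v) (D \ Ω)} ∧
      IsMinOn (pEnergy f) {v : SobolevZero D p | VanishesOn (sobolevVal v) (D \ Ω)} u :=
  Iff.rfl

theorem IsMorreyDomain.vanishesOn_diff_iff (h : IsMorreyDomain D p)
    {Ω : Set (EuclideanSpace ℝ (Fin d))} {u : SobolevZero D p} :
    VanishesOn (sobolevVal u) (D \ Ω) ↔ ∀ x ∉ Ω, continuousRep (sobolevVal u) x = 0 := by
  rw [h.vanishesOn_iff]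
  refine ⟨fun hu x hx => ?_, fun hu x hx => hu x hx.2⟩
  by_cases hxD : x ∈ D
  · exact hu x ⟨hxD, hx⟩
  · exact h.rep_eq_zero u hxD

/-- Boundedness is Morrey's sup bound. It makes the zero constraints closed linear conditions. -/
theorem IsMorreyDomain.exists_evalCLM (h : IsMorreyDomain D p) (x : EuclideanSpace ℝ (Fin d)) :
    ∃ L : SobolevZero D p →L[ℝ] ℝ, ∀ u, L u = continuousRep (sobolevVal u) x := by
  obtain ⟨C, hC, hb⟩ := h.exists_rep_bound
  let L : SobolevZero D p →ₗ[ℝ] ℝ :=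
    { toFun := fun u => continuousRep (sobolevVal u) x
      map_add' := fun u v => congrFun (h.rep_add u v) x
      map_smul' := fun c u => congrFun (h.rep_smul c u) x }
  refine ⟨L.mkContinuous C fun u => ((hb u).2 x).trans ?_, fun u => rfl⟩
  gcongr
  exact le_max_right _ _

theorem IsMorreyDomain.isClosed_vanishesOn (h : IsMorreyDomain D p)
    (S : Set (EuclideanSpace ℝ (Fin d))) :
    IsClosed {v : SobolevZero D p | VanishesOn (sobolevVal v) S} := by
  simp only [h.vanishesOn_iff, ofPred_forall]
  refine isClosed_iInter fun x => isClosed_iInter fun _ => ?_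
  obtain ⟨L, hL⟩ := h.exists_evalCLM x
  simp only [← hL]
  exact isClosed_eq L.continuous continuous_const

theorem IsMorreyDomain.midpoint_vanishesOn (h : IsMorreyDomain D p)
    {S : Set (EuclideanSpace ℝ (Fin d))} {u v : SobolevZero D p}
    (hu : VanishesOn (sobolevVal u) S) (hv : VanishesOn (sobolevVal v) S) :
    VanishesOn (sobolevVal ((1 / 2 : ℝ) • (u + v))) S := by
  rw [h.vanishesOn_iff] at hu hv ⊢
  intro x hx
  rw [h.rep_smul, h.rep_add, Pi.smul_apply, Pi.add_apply, hu x hx, hv x hx]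
  simp

/-- Existence is the nested-set lemma for a constant sequence, with `B` the infimum of the energy.
-/
theorem IsMorreyDomain.existsUnique_isState (h : IsMorreyDomain D p)
    (f : SobolevZero D p →L[ℝ] ℝ) (Ω : Set (EuclideanSpace ℝ (Fin d))) :
    ∃! u : SobolevZero D p, IsState f Ω u := by
  set K : Set (SobolevZero D p) := {v | VanishesOn (sobolevVal v) (D \ Ω)} with hK
  have hmid : ∀ u ∈ K, ∀ v ∈ K, (1 / 2 : ℝ) • (u + v) ∈ K := fun u hu v hv =>
    h.midpoint_vanishesOn hu hv
  obtain ⟨b, hb⟩ := h.exists_le_pEnergy f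
  have hbdd : BddBelow (pEnergy f '' K) := ⟨b, by rintro _ ⟨u, -, rfl⟩; exact hb u⟩
  have h0 : (0 : SobolevZero D p) ∈ K :=
    ⟨0, continuous_const, (Lp.coeFn_zero ..).symm, fun _ _ => rfl⟩
  obtain ⟨w, hwK, hw⟩ := h.exists_mem_forall_pEnergy_le f (F := fun _ => K) antitone_const
    (fun _ => h.isClosed_vanishesOn _) (fun _ => hmid) (B := sInf (pEnergy f '' K)) (by
      intro _ δ hδ
      obtain ⟨_, ⟨u, hu, rfl⟩, hlt⟩ := exists_lt_of_csInf_lt (⟨_, 0, h0, rfl⟩ :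
        (pEnergy f '' K).Nonempty) (lt_add_of_pos_right _ hδ)
      exact ⟨u, hu, hlt.le⟩)
  have hwm : IsMinOn (pEnergy f) K w := isMinOn_iff.2 fun v hv =>
    hw.trans (csInf_le hbdd ⟨v, hv, rfl⟩)
  refine ⟨w, isState_iff.2 ⟨hwK 0, hwm⟩, fun v hv => ?_⟩
  obtain ⟨hvK, hvm⟩ := isState_iff.1 hv
  exact h.eq_of_isMinOn f hmid hvK (hwK 0) hvm hwm

/-- Kuratowski-type convergence of the complements of `Ω n` to the complement of `Ω₀`. -/
structure DomainTendsto {E : Type*} [PseudoMetricSpace E] (Ω : ℕ → Set E) (Ω₀ : Set E) : Prop where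
  eventually_subset : ∀ K : Set E, IsCompact K → K ⊆ Ω₀ → ∀ᶠ n in atTop, K ⊆ Ω n
  eventually_near : ∀ x ∉ Ω₀, ∀ ε > 0, ∀ᶠ n in atTop, ∃ y ∉ Ω n, dist x y < ε

/-- Compactness of the family of open sets for the convergence of domains. -/
theorem exists_subseq_domainTendsto {E : Type*} [PseudoMetricSpace E] [SecondCountableTopology E]
    (Ω : ℕ → Set E) :
    ∃ (k : ℕ → ℕ) (Ω₀ : Set E), StrictMono k ∧ IsOpen Ω₀ ∧ DomainTendsto (Ω ∘ k) Ω₀ := by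
  classical
  set b := TopologicalSpace.countableBasis E with hb
  have hbasis := TopologicalSpace.isBasis_countableBasis E
  have : Countable b := (TopologicalSpace.countable_countableBasis E).to_subtype
  -- Each set is encoded by which basic open sets it contains. The space of codes is compact and,
  -- the basis being countable, sequentially compact.
  obtain ⟨β, k, hk, hlim⟩ := CompactSpace.tendsto_subseq
    (fun n => fun B : b => decide ((B : Set E) ⊆ Ω n))
  have hev : ∀ B : b, ∀ᶠ n in atTop, decide ((B : Set E) ⊆ Ω (k n)) = β B := by
    intro B
    have h1 := tendsto_pi_nhds.1 hlim B
    rw [nhds_discrete, tendsto_pure] at h1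
    exact h1
  -- The limit is the union of the basic sets eventually contained in `Ω (k n)`. A basic set around
  -- a point outside it eventually meets the complements.
  refine ⟨k, ⋃ B : {B : b // β B = true}, (B.1 : Set E), hk,
    isOpen_iUnion fun B => hbasis.isOpen B.1.2, ?_, ?_⟩
  · intro K hK hsub
    obtain ⟨t, ht⟩ := hK.elim_finite_subcover _ (fun B => hbasis.isOpen B.1.2) hsub
    have h1 : ∀ᶠ n in atTop, ∀ B ∈ t, (B.1 : Set E) ⊆ Ω (k n) :=
      (Filter.eventually_all_finset t).2 fun B _ => by
        filter_upwards [hev B.1] with n hn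
        rw [B.2] at hn
        exact of_decide_eq_true hn
    filter_upwards [h1] with n hn
    exact ht.trans (iUnion₂_subset hn)
  · intro x hx ε hε
    obtain ⟨B, hB, hxB, hBε⟩ := hbasis.exists_subset_of_mem_open (Metric.mem_ball_self hε)
      Metric.isOpen_ball
    have hβ : β ⟨B, hB⟩ = false := by
      by_contra hne
      exact hx (mem_iUnion.2 ⟨⟨⟨B, hB⟩, by simpa using hne⟩, hxB⟩)
    filter_upwards [hev ⟨B, hB⟩] with n hn
    rw [hβ] at hn
    obtain ⟨y, hy, hyn⟩ := not_subset.1 (of_decide_eq_false hn)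
    exact ⟨y, hyn, by rw [dist_comm]; exact hBε hy⟩

theorem DomainTendsto.subset {E : Type*} [PseudoMetricSpace E] {Ω : ℕ → Set E} {Ω₀ S : Set E}
    (h : DomainTendsto Ω Ω₀) (hS : ∀ n, Ω n ⊆ S) : Ω₀ ⊆ S := fun x hx => by
  obtain ⟨n, hn⟩ := (h.eventually_subset {x} isCompact_singleton (singleton_subset_iff.2 hx)).exists
  exact hS n (hn rfl)

/-- Inner regularity: every compact subset of `Ω₀` lies in some `Ω n`. -/
theorem DomainTendsto.measure_le {E : Type*} [PseudoMetricSpace E] [MeasurableSpace E]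
    {μ : Measure E} [μ.Regular] {Ω : ℕ → Set E} {Ω₀ : Set E} (h : DomainTendsto Ω Ω₀)
    (hΩ₀ : IsOpen Ω₀) {c : ℝ≥0∞} (hc : ∀ n, μ (Ω n) ≤ c) : μ Ω₀ ≤ c := by
  rw [hΩ₀.measure_eq_iSup_isCompact]
  refine iSup₂_le fun K hK => iSup_le fun hKc => ?_
  obtain ⟨n, hn⟩ := (h.eventually_subset K hKc hK).exists
  exact (measure_mono hn).trans (hc n)

theorem DomainTendsto.isAdmissible {Ω : ℕ → Set (EuclideanSpace ℝ (Fin d))}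
    {Ω₀ : Set (EuclideanSpace ℝ (Fin d))} {m : ℝ} (h : DomainTendsto Ω Ω₀) (hΩ₀ : IsOpen Ω₀)
    (hadm : ∀ n, IsAdmissible D m (Ω n)) : IsAdmissible D m Ω₀ :=
  ⟨hΩ₀, h.subset fun n => (hadm n).2.1, h.measure_le hΩ₀ fun n => (hadm n).2.2⟩

set_option maxHeartbeats 800000 in
-- A point `x ∉ Ω₀` is approached by points `y ∉ Ω n` at which `u n` vanishes, so the uniform Hölder
-- bound makes `|u n x|` small for all large `n`. This bound passes to closed convex hulls of tails.
theorem IsMorreyDomain.vanishesOn_of_domainTendsto (h : IsMorreyDomain D p)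
    {Ω : ℕ → Set (EuclideanSpace ℝ (Fin d))} {Ω₀ : Set (EuclideanSpace ℝ (Fin d))}
    (hΩ : DomainTendsto Ω Ω₀) {u : ℕ → SobolevZero D p}
    (hu : ∀ n, VanishesOn (sobolevVal (u n)) (D \ Ω n)) {M : ℝ}
    (hM : ∀ᶠ n in atTop, ‖sobolevGradLp (u n)‖ ≤ M) {w : SobolevZero D p}
    (hw : ∀ N, w ∈ closure (convexHull ℝ (u '' Ici N))) :
    VanishesOn (sobolevVal w) (D \ Ω₀) := by
  obtain ⟨C, hC, hb⟩ := h.exists_rep_bound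
  set α := 1 - (d : ℝ) / p.toReal with hα
  have hα0 : 0 < α := h.exponent_pos
  rw [h.vanishesOn_diff_iff]
  intro x hx
  obtain ⟨L, hL⟩ := h.exists_evalCLM x
  rw [← hL, ← abs_nonpos_iff]
  refine le_of_forall_pos_le_add fun η hη => ?_
  rw [zero_add]
  have hcont : Tendsto (fun t : ℝ => C * t ^ α * M) (𝓝 0) (𝓝 0) := by
    have h1 : ContinuousAt (fun t : ℝ => C * t ^ α * M) 0 :=
      ((Real.continuousAt_rpow_const 0 α (Or.inr hα0.le)).const_mul C).mul_const M
    simpa [ContinuousAt, Real.zero_rpow hα0.ne'] using h1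
  obtain ⟨ε, hε, hεη⟩ := Metric.eventually_nhds_iff.1 (hcont.eventually (gt_mem_nhds hη))
  obtain ⟨N, hN⟩ := eventually_atTop.1 ((hΩ.eventually_near x hx ε hε).and hM)
  refine abs_apply_le_of_mem_closure_convexHull L ?_ (hw N)
  rintro _ ⟨n, hn, rfl⟩
  obtain ⟨⟨y, hy, hxy⟩, hMn⟩ := hN n hn
  have h1 := (hb (u n)).1 x y
  rw [h.vanishesOn_diff_iff.1 (hu n) y hy, sub_zero, ← hL] at h1
  refine h1.trans (le_trans ?_ (hεη (y := dist x y) (by simpa using hxy)).le)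
  gcongr

/-- A truncation of `u₀` with nearly the same energy vanishes off the compact set `{ε ≤ |u₀|} ⊆ Ω₀`,
which `Ω n` eventually contains. It is then a competitor for `u n`. -/
theorem IsMorreyDomain.eventually_pEnergy_le (h : IsMorreyDomain D p)
    (f : SobolevZero D p →L[ℝ] ℝ)
    {Ω : ℕ → Set (EuclideanSpace ℝ (Fin d))} {Ω₀ : Set (EuclideanSpace ℝ (Fin d))}
    (hΩ : DomainTendsto Ω Ω₀) {u : ℕ → SobolevZero D p}
    {u₀ : SobolevZero D p} (hu : ∀ n, IsState f (Ω n) (u n))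
    (hu₀ : VanishesOn (sobolevVal u₀) (D \ Ω₀)) {δ : ℝ} (hδ : 0 < δ) :
    ∀ᶠ n in atTop, pEnergy f (u n) ≤ pEnergy f u₀ + δ := by
  rw [h.vanishesOn_diff_iff] at hu₀
  obtain ⟨w, hw, hwv⟩ := h.exists_truncation u₀
  have h1 : Tendsto (fun k => pEnergy f (w k)) atTop (𝓝 (pEnergy f u₀)) :=
    ((h.continuous_pEnergy f).tendsto u₀).comp hw
  obtain ⟨k, hk⟩ := (h1.eventually (gt_mem_nhds (lt_add_of_pos_right _ hδ))).exists
  obtain ⟨ε, hε, hv⟩ := hwv k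
  have hsub : {x | ε ≤ |continuousRep (sobolevVal u₀) x|} ⊆ Ω₀ := by
    intro x hx
    by_contra hxΩ
    rw [mem_ofPred_eq, hu₀ x hxΩ, abs_zero] at hx
    exact hε.not_ge hx
  filter_upwards [hΩ.eventually_subset _ (h.isCompact_le_abs_rep u₀ hε) hsub] with n hn
  refine ((hu n).2 (w k) ?_).trans hk.le
  rw [h.vanishesOn_diff_iff]
  intro x hx
  refine hv x (le_of_not_ge fun hle => hx (hn hle))

set_option maxHeartbeats 1000000 in
/-- Continuity of the state with respect to the convergence of domains. -/
theorem IsMorreyDomain.tendsto_state (h : IsMorreyDomain D p) (f : SobolevZero D p →L[ℝ] ℝ)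
    {Ω : ℕ → Set (EuclideanSpace ℝ (Fin d))} {Ω₀ : Set (EuclideanSpace ℝ (Fin d))}
    (hΩ : DomainTendsto Ω Ω₀) {u : ℕ → SobolevZero D p}
    {u₀ : SobolevZero D p} (hu : ∀ n, IsState f (Ω n) (u n)) (hu₀ : IsState f Ω₀ u₀) :
    Tendsto u atTop (𝓝 u₀) := by
  have hup : ∀ δ > 0, ∀ᶠ n in atTop, pEnergy f (u n) ≤ pEnergy f u₀ + δ := fun δ hδ =>
    h.eventually_pEnergy_le f hΩ hu hu₀.1 hδ
  obtain ⟨M, -, hM⟩ := h.exists_grad_le f (pEnergy f u₀ + 1)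
  have hbound : ∀ᶠ n in atTop, ‖sobolevGradLp (u n)‖ ≤ M := (hup 1 one_pos).mono fun n hn => hM _ hn
  -- Points common to all these sets replace weak limit points.
  set F : ℕ → Set (SobolevZero D p) := fun N => closure (convexHull ℝ (u '' Ici N)) with hF
  have hmem : ∀ N, ∀ n ≥ N, u n ∈ F N := fun N n hn =>
    subset_closure (subset_convexHull ℝ _ ⟨n, hn, rfl⟩)
  have hanti : Antitone F := fun m n hmn =>
    closure_mono (convexHull_mono (image_mono (Ici_subset_Ici.2 hmn)))
  have hmid : ∀ n, ∀ a ∈ F n, ∀ b ∈ F n, (1 / 2 : ℝ) • (a + b) ∈ F n :=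
    fun n a ha b hb => midpoint_mem_closure_convexHull ha hb
  have hinter : ∀ w, (∀ n, w ∈ F n) → VanishesOn (sobolevVal w) (D \ Ω₀) := fun w hw =>
    h.vanishesOn_of_domainTendsto hΩ (fun n => (hu n).1) hbound hw
  -- Otherwise the nested-set lemma yields a common point of energy at most `pEnergy f u₀ - δ`; it
  -- vanishes off `Ω₀`, against the minimality of `u₀`.
  have hlow : ∀ δ > 0, ∃ N, ∀ w ∈ F N, pEnergy f u₀ - δ < pEnergy f w := by
    intro δ hδ
    by_contra! hcon
    obtain ⟨w, hw, hle⟩ := h.exists_mem_forall_pEnergy_le f hanti (fun _ => isClosed_closure) hmid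
      (B := pEnergy f u₀ - δ) fun n δ' hδ' => by
        obtain ⟨w, hw, hle⟩ := hcon n
        exact ⟨w, hw, by linarith⟩
    linarith [hu₀.2 w (hinter w hw)]
  have hcau : CauchySeq u := by
    refine h.cauchySeq_of_midpoint f (hup 1 one_pos) fun δ hδ => ?_
    obtain ⟨N₁, hN₁⟩ := eventually_atTop.1 (hup (δ / 2) (half_pos hδ))
    obtain ⟨N₂, hN₂⟩ := hlow (δ / 2) (half_pos hδ)
    refine ⟨max N₁ N₂, fun m hm n hn => ?_⟩
    have h1 := hN₂ _ (hmid N₂ _ (hmem N₂ m ((le_max_right _ _).trans hm)) _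
      (hmem N₂ n ((le_max_right _ _).trans hn)))
    linarith [hN₁ m ((le_max_left _ _).trans hm), hN₁ n ((le_max_left _ _).trans hn)]
  obtain ⟨w, hw⟩ := cauchySeq_tendsto_of_complete hcau
  have hwF : ∀ N, w ∈ F N := fun N => isClosed_closure.mem_of_tendsto hw
    ((eventually_ge_atTop N).mono fun n hn => hmem N n hn)
  have hwE : pEnergy f w ≤ pEnergy f u₀ := le_of_forall_pos_le_add fun δ hδ =>
    le_of_tendsto (((h.continuous_pEnergy f).tendsto w).comp hw) (hup δ hδ)
  have hws : IsState f Ω₀ w := ⟨hinter w hwF, fun v hv => hwE.trans (hu₀.2 v hv)⟩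
  rwa [(h.existsUnique_isState f Ω₀).unique hu₀ hws]

end States

/-! ### Lower semicontinuity of the cost. -/

section Cost

open Set Filter Topology

/-- Integrate `h⁺ + b = (h + b) + h⁻`, where every term is nonnegative. The integrals of `h⁻` and
`b` are finite, so rearranging in `EReal` is legitimate even when that of `h⁺` is infinite. -/
theorem lintegral_ofReal_sub_eq {α : Type*} [MeasurableSpace α] {μ : Measure α} {h b : α → ℝ}
    (hh : AEMeasurable h μ) (hb : AEMeasurable b μ) (hb0 : ∀ x, 0 ≤ b x)
    (hle : ∀ᵐ x ∂μ, -b x ≤ h x) (hfin : ∫⁻ x, ENNReal.ofReal (b x) ∂μ ≠ ⊤) :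
    ((∫⁻ x, ENNReal.ofReal (h x) ∂μ : ℝ≥0∞) : EReal) -
        ((∫⁻ x, ENNReal.ofReal (-h x) ∂μ : ℝ≥0∞) : EReal) =
      ((∫⁻ x, ENNReal.ofReal (h x + b x) ∂μ : ℝ≥0∞) : EReal) -
        ((∫⁻ x, ENNReal.ofReal (b x) ∂μ : ℝ≥0∞) : EReal) := by
  have hN : ∫⁻ x, ENNReal.ofReal (-h x) ∂μ ≠ ⊤ := by
    refine ne_top_of_le_ne_top hfin (lintegral_mono_ae ?_)
    filter_upwards [hle] with x hx
    exact ENNReal.ofReal_le_ofReal (by linarith)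
  have key : ∫⁻ x, ENNReal.ofReal (h x) ∂μ + ∫⁻ x, ENNReal.ofReal (b x) ∂μ =
      ∫⁻ x, ENNReal.ofReal (h x + b x) ∂μ + ∫⁻ x, ENNReal.ofReal (-h x) ∂μ := by
    have hhb : AEMeasurable (fun x => h x + b x) μ := hh.add hb
    rw [← lintegral_add_left' hh.ennreal_ofReal, ← lintegral_add_left' hhb.ennreal_ofReal]
    refine lintegral_congr_ae ?_
    filter_upwards [hle] with x hx
    have hbx := hb0 x
    rcases le_total 0 (h x) with h0 | h0
    · rw [ENNReal.ofReal_of_nonpos (by linarith : -h x ≤ 0), add_zero, ENNReal.ofReal_add h0 hbx]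
    · rw [ENNReal.ofReal_of_nonpos h0, zero_add,
        ← ENNReal.ofReal_add (by linarith) (by linarith)]
      congr 1
      ring
  generalize ∫⁻ x, ENNReal.ofReal (h x) ∂μ = P at *
  generalize ∫⁻ x, ENNReal.ofReal (h x + b x) ∂μ = G at *
  generalize ∫⁻ x, ENNReal.ofReal (-h x) ∂μ = N at *
  generalize ∫⁻ x, ENNReal.ofReal (b x) ∂μ = A at *
  lift N to NNReal using hN
  lift A to NNReal using hfin
  by_cases hP : P = ⊤
  · have hG : G = ⊤ := by
      rw [hP, top_add] at key
      rcases ENNReal.add_eq_top.1 key.symm with h' | h'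
      · exact h'
      · exact absurd h' ENNReal.coe_ne_top
    rw [hP, hG]
    rfl
  · have hG : G ≠ ⊤ := by
      rintro rfl
      rw [top_add] at key
      exact ENNReal.add_ne_top.2 ⟨hP, ENNReal.coe_ne_top⟩ key
    lift P to NNReal using hP
    lift G to NNReal using hG
    norm_cast at key
    have key' : (P : ℝ) + A = G + N := by exact_mod_cast key
    have e : ∀ a : NNReal, ((a : ℝ≥0∞) : EReal) = ((a : ℝ) : EReal) := fun a => rfl
    rw [e, e, e, e, ← EReal.coe_sub, ← EReal.coe_sub]
    congr 1
    linarith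

theorem le_liminf_ofReal_of_lowerSemicontinuous {g : ℝ → ℝ} (hg : LowerSemicontinuous g) (b : ℝ)
    {s : ℕ → ℝ} {t : ℝ} (hs : Tendsto s atTop (𝓝 t)) :
    ENNReal.ofReal (g t + b) ≤ liminf (fun n => ENNReal.ofReal (g (s n) + b)) atTop := by
  have h1 : LowerSemicontinuous fun x => ENNReal.ofReal (g x + b) :=
    Continuous.comp_lowerSemicontinuous (g := fun y => ENNReal.ofReal (y + b))
      (ENNReal.continuous_ofReal.comp (continuous_id.add continuous_const)) hg
      fun x y hxy => ENNReal.ofReal_le_ofReal (by linarith)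
  have h2 := lowerSemicontinuousAt_iff_le_liminf.1 (h1 t)
  exact h2.trans (liminf_le_liminf_of_le hs)

/-- As `j` is only Lebesgue measurable in `x`, the composition is formed on the completed σ-algebra
and then compared with the Borel one up to null sets. -/
theorem aemeasurable_comp_of_nullMeasurable {E : Type*} [MeasurableSpace E] {μ : Measure E}
    {j : E → ℝ → ℝ} (hj : Measurable (fun z : NullMeasurableSpace E μ × ℝ => j z.1 z.2))
    {v : E → ℝ} (hv : Measurable v) : AEMeasurable (fun x => j x (v x)) μ := by
  have h1 : Measurable (fun x : NullMeasurableSpace E μ => v x) :=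
    (hv.nullMeasurable (μ := μ)).measurable'
  have h2 : Measurable (fun x : NullMeasurableSpace E μ => j x (v x)) :=
    hj.comp (measurable_id.prodMk h1)
  have h3 : NullMeasurable (fun x => j x (v x)) μ := fun s hs => h2 hs
  exact h3.aemeasurable

variable {d : ℕ} {p : ℝ≥0∞} {D : Set (EuclideanSpace ℝ (Fin d))}
  {j : EuclideanSpace ℝ (Fin d) → ℝ → ℝ}

theorem costPos_congr {u v : EuclideanSpace ℝ (Fin d) → ℝ} (huv : u =ᵐ[volume] v) :
    costPos D j u = costPos D j v :=
  lintegral_congr_ae ((ae_restrict_of_ae huv).mono fun x hx => by dsimp only; rw [hx])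

theorem costNeg_congr {u v : EuclideanSpace ℝ (Fin d) → ℝ} (huv : u =ᵐ[volume] v) :
    costNeg D j u = costNeg D j v :=
  lintegral_congr_ae ((ae_restrict_of_ae huv).mono fun x hx => by dsimp only; rw [hx])

theorem cost_congr {u v : EuclideanSpace ℝ (Fin d) → ℝ} (huv : u =ᵐ[volume] v) :
    cost D j u = cost D j v := by
  rw [cost, cost, costPos_congr huv, costNeg_congr huv]

/-- **Fatou's lemma** for the cost functional. -/
theorem cost_le_of_tendsto
    (hjmeas : Measurable (fun z : NullMeasurableSpace (EuclideanSpace ℝ (Fin d)) volume × ℝ =>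
      j z.1 z.2))
    (hjlsc : ∀ᵐ x ∂(volume.restrict D), LowerSemicontinuous (j x))
    {M : ℝ} {a : EuclideanSpace ℝ (Fin d) → ℝ} (ha : IntegrableOn a D volume)
    (haj : ∀ᵐ x ∂(volume.restrict D), ∀ s : ℝ, |s| ≤ M → -a x ≤ j x s)
    {v : ℕ → EuclideanSpace ℝ (Fin d) → ℝ} {v₀ : EuclideanSpace ℝ (Fin d) → ℝ}
    (hv : ∀ n, Continuous (v n)) (hv₀ : Continuous v₀) (hM : ∀ n x, |v n x| ≤ M)
    (hlim : ∀ x, Tendsto (fun n => v n x) atTop (𝓝 (v₀ x))) {c : EReal}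
    (hc : Tendsto (fun n => cost D j (v n)) atTop (𝓝 c)) : cost D j v₀ ≤ c := by
  have hM₀ : ∀ x, |v₀ x| ≤ M := fun x => le_of_tendsto' (hlim x).abs fun n => hM n x
  have hfin : ∫⁻ x in D, ENNReal.ofReal |a x| ≠ ⊤ := by
    have := ha.2
    simp only [HasFiniteIntegral, ← ofReal_norm, Real.norm_eq_abs] at this
    exact this.ne
  have hmeas : ∀ {w : EuclideanSpace ℝ (Fin d) → ℝ}, Continuous w →
      AEMeasurable (fun x => j x (w x)) (volume.restrict D) := fun hw =>
    (aemeasurable_comp_of_nullMeasurable hjmeas hw.measurable).restrict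
  have ham : AEMeasurable (fun x => |a x|) (volume.restrict D) := ha.1.aemeasurable.abs
  set A : ℝ≥0∞ := ∫⁻ x in D, ENNReal.ofReal |a x| with hA
  have hcost : ∀ {w : EuclideanSpace ℝ (Fin d) → ℝ}, Continuous w → (∀ x, |w x| ≤ M) →
      cost D j w = ((∫⁻ x in D, ENNReal.ofReal (j x (w x) + |a x|) : ℝ≥0∞) : EReal) - A := by
    intro w hw hwM
    refine lintegral_ofReal_sub_eq (hmeas hw) ham (fun x => abs_nonneg _) ?_ hfin
    filter_upwards [haj] with x hx
    have := hx (w x) (hwM x)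
    linarith [le_abs_self (a x)]
  rw [hcost hv₀ hM₀]
  have hfatou : ∫⁻ x in D, ENNReal.ofReal (j x (v₀ x) + |a x|) ≤
      liminf (fun n => ∫⁻ x in D, ENNReal.ofReal (j x (v n x) + |a x|)) atTop := by
    refine le_trans (lintegral_mono_ae ?_)
      (lintegral_liminf_le' fun n => ((hmeas (hv n)).add ham).ennreal_ofReal)
    filter_upwards [hjlsc] with x hx
    exact le_liminf_ofReal_of_lowerSemicontinuous hx _ (hlim x)
  clear_value A
  lift A to NNReal using hfin
  have hAe : ((A : ℝ≥0∞) : EReal) = ((A : ℝ) : EReal) := rfl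
  -- Adding the finite constant `A` makes the costs nonnegative, so that their limit can be compared
  -- with the Fatou bound in `ℝ≥0∞`, even if `c = ⊤`.
  have hG : ∀ n, cost D j (v n) + ((A : ℝ) : EReal) =
      ((∫⁻ x in D, ENNReal.ofReal (j x (v n x) + |a x|) : ℝ≥0∞) : EReal) := by
    intro n
    rw [hcost (hv n) (hM n), hAe, EReal.sub_add_cancel]
  have ht : Tendsto (fun n => cost D j (v n) + ((A : ℝ) : EReal)) atTop
      (𝓝 (c + ((A : ℝ) : EReal))) := by
    have hca := EReal.continuousAt_add (p := (c, ((A : ℝ) : EReal)))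
      (Or.inr (EReal.coe_ne_bot _)) (Or.inr (EReal.coe_ne_top _))
    exact hca.tendsto.comp (hc.prodMk_nhds tendsto_const_nhds)
  simp only [hG] at ht
  have hnn : 0 ≤ c + ((A : ℝ) : EReal) := ge_of_tendsto' ht fun n => EReal.coe_ennreal_nonneg _
  have ht' := (EReal.continuous_toENNReal.tendsto _).comp ht
  simp only [Function.comp_def, EReal.toENNReal_coe] at ht'
  rw [ht'.liminf_eq] at hfatou
  rw [hAe]
  refine EReal.sub_le_of_le_add ?_
  rw [← EReal.coe_toENNReal hnn]
  exact EReal.coe_ennreal_le_coe_ennreal_iff.2 hfatou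

variable [Fact (1 ≤ p)]

theorem IsMorreyDomain.costNeg_lt_top (h : IsMorreyDomain D p)
    (hjbdd : ∀ M : ℝ, 0 < M → ∃ a : EuclideanSpace ℝ (Fin d) → ℝ, IntegrableOn a D volume ∧
      ∀ᵐ x ∂(volume.restrict D), ∀ s : ℝ, |s| ≤ M → -a x ≤ j x s) (u : SobolevZero D p) :
    costNeg D j (sobolevVal u) < ⊤ := by
  obtain ⟨C, hC, hb⟩ := h.exists_rep_bound
  -- The `+ 1` ensures a positive bound, as `hjbdd` requires.
  obtain ⟨a, ha, haj⟩ := hjbdd (C * ‖sobolevGradLp u‖ + 1) (by positivity)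
  rw [← costNeg_congr (h.rep_ae_eq u)]
  refine lt_of_le_of_lt (lintegral_mono_ae ?_) ha.2
  filter_upwards [haj] with x hx
  have h1 := hx _ (((hb u).2 x).trans (by linarith))
  rw [← ofReal_norm, Real.norm_eq_abs]
  exact ENNReal.ofReal_le_ofReal (by linarith [le_abs_self (a x)])

/-- Convergence in the Sobolev norm bounds the gradients, hence all representatives by one constant,
and gives pointwise convergence through the evaluation functionals. -/
theorem IsMorreyDomain.cost_le_of_tendsto (h : IsMorreyDomain D p)
    (hjmeas : Measurable (fun z : NullMeasurableSpace (EuclideanSpace ℝ (Fin d)) volume × ℝ =>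
      j z.1 z.2))
    (hjlsc : ∀ᵐ x ∂(volume.restrict D), LowerSemicontinuous (j x))
    (hjbdd : ∀ M : ℝ, 0 < M → ∃ a : EuclideanSpace ℝ (Fin d) → ℝ, IntegrableOn a D volume ∧
      ∀ᵐ x ∂(volume.restrict D), ∀ s : ℝ, |s| ≤ M → -a x ≤ j x s)
    {u : ℕ → SobolevZero D p} {u₀ : SobolevZero D p} (hu : Tendsto u atTop (𝓝 u₀)) {c : EReal}
    (hc : Tendsto (fun n => cost D j (sobolevVal (u n))) atTop (𝓝 c)) :
    cost D j (sobolevVal u₀) ≤ c := by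
  obtain ⟨C, hC, hb⟩ := h.exists_rep_bound
  obtain ⟨M, hM⟩ := ((sobolevGradLp.continuous.tendsto u₀).comp hu).norm.bddAbove_range
  have hM' : ∀ n, ‖sobolevGradLp (u n)‖ ≤ M := fun n => hM ⟨n, rfl⟩
  have hM0 : 0 ≤ M := (norm_nonneg _).trans (hM' 0)
  obtain ⟨a, ha, haj⟩ := hjbdd (C * M + 1) (by positivity)
  rw [← cost_congr (h.rep_ae_eq u₀)]
  simp only [← cost_congr (h.rep_ae_eq (u _))] at hc
  refine _root_.cost_le_of_tendsto hjmeas hjlsc ha haj (fun n => h.continuous_rep (u n))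
    (h.continuous_rep u₀) (fun n x => ((hb (u n)).2 x).trans ?_) (fun x => ?_) hc
  · have : C * ‖sobolevGradLp (u n)‖ ≤ C * M := by gcongr; exact hM' n
    linarith
  · obtain ⟨L, hL⟩ := h.exists_evalCLM x
    simp only [← hL]
    exact (L.continuous.tendsto u₀).comp hu

end Cost

/-! ### The direct method. -/

theorem theorem1p2 {d : ℕ} (hd : 1 ≤ d) (p : ℝ≥0∞) [Fact (1 ≤ p)] (hdp : (d : ℝ≥0∞) < p)
    (hp : p ≠ ⊤)
    (D : Set (EuclideanSpace ℝ (Fin d))) (hD : IsOpen D) (hDfin : volume D < ⊤)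
    (f : SobolevZero D p →L[ℝ] ℝ)
    (m : ℝ) (hm : 0 < m) (hmD : ENNReal.ofReal m ≤ volume D)
    (j : EuclideanSpace ℝ (Fin d) → ℝ → ℝ)
    -- `j` is measurable for the product of the Lebesgue and the Borel σ-algebras
    (hjmeas : Measurable (fun z : NullMeasurableSpace (EuclideanSpace ℝ (Fin d)) volume × ℝ =>
      j z.1 z.2))
    (hjlsc : ∀ᵐ x ∂(volume.restrict D), LowerSemicontinuous (j x))
    (hjbdd : ∀ M : ℝ, 0 < M → ∃ a : EuclideanSpace ℝ (Fin d) → ℝ, IntegrableOn a D volume ∧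
      ∀ᵐ x ∂(volume.restrict D), ∀ s : ℝ, |s| ≤ M → -a x ≤ j x s) :
    -- every open `Ω ⊆ D` has exactly one state function, and its cost is well defined
    (∀ Ω : Set (EuclideanSpace ℝ (Fin d)), IsOpen Ω → Ω ⊆ D →
      (∃! u : SobolevZero D p, IsState f Ω u) ∧
        ∀ u : SobolevZero D p, IsState f Ω u → costNeg D j (sobolevVal u) < ⊤) ∧
    -- the shape optimization problem has a solution
    ∃ (Ωopt : Set (EuclideanSpace ℝ (Fin d))) (uopt : SobolevZero D p),
      IsAdmissible D m Ωopt ∧ IsState f Ωopt uopt ∧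
        ∀ (Ω : Set (EuclideanSpace ℝ (Fin d))) (u : SobolevZero D p),
          IsAdmissible D m Ω → IsState f Ω u → cost D j (sobolevVal uopt) ≤ cost D j (sobolevVal u) := by
  have h : IsMorreyDomain D p := ⟨hd, hdp, hp, hD, hDfin⟩
  refine ⟨fun Ω _ _ => ⟨h.existsUnique_isState f Ω, fun u _ => h.costNeg_lt_top hjbdd u⟩, ?_⟩
  -- The infimum is taken in `EReal`, so a minimizing sequence exists even if every cost is `⊤`; the
  -- empty set is admissible.
  set S : Set EReal := {c | ∃ (Ω : Set (EuclideanSpace ℝ (Fin d))) (u : SobolevZero D p),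
    IsAdmissible D m Ω ∧ IsState f Ω u ∧ c = cost D j (sobolevVal u)} with hS
  have hne : S.Nonempty := by
    obtain ⟨u, hu, -⟩ := h.existsUnique_isState f ∅
    exact ⟨_, ∅, u, ⟨isOpen_empty, Set.empty_subset _, by simp⟩, hu, rfl⟩
  obtain ⟨c, -, hc, hcS⟩ := exists_seq_tendsto_sInf hne (OrderBot.bddBelow S)
  choose Ω u hadm hst hcost using hcS
  obtain ⟨k, Ω₀, hk, hopen, hΩ⟩ := exists_subseq_domainTendsto Ω
  obtain ⟨u₀, hu₀, -⟩ := h.existsUnique_isState f Ω₀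
  have hlim : Filter.Tendsto (u ∘ k) Filter.atTop (nhds u₀) :=
    h.tendsto_state f hΩ (fun n => hst (k n)) hu₀
  refine ⟨Ω₀, u₀, hΩ.isAdmissible hopen fun n => hadm (k n), hu₀, fun Ω' u' h1 h2 => ?_⟩
  refine (h.cost_le_of_tendsto hjmeas hjlsc hjbdd hlim (c := sInf S) ?_).trans
    (sInf_le ⟨Ω', u', h1, h2, rfl⟩)
  have h3 := hc.comp hk.tendsto_atTop
  rwa [funext hcost] at h3
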